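/- Let $A$ be a commutative ring, $e_1,e_2,e_3$ the standard basis of $\mathbb Z^3$, and call $x+y+z$ the *time* of $(x,y,z)$. The *cube relation* at $p\in\mathbb Z^3$ for $\theta:\mathbb Z^3\to A^\times$ is $$\theta_p\,\theta_{p+e_1+e_2+e_3}=\theta_{p+e_1}\theta_{p+e_2+e_3}+\theta_{p+e_2}\theta_{p+e_1+e_3}.$$ **Surfaces.** Fix $a,b,c\in\mathbb Z$ and $N\ge 1$, and put $m=a+b+c-2-N$ (for $N=a+b+c-2$ one has $m=0$). Let $Q_N$ be the set of unit cubes, given by their bottom vertices $p$, with $p+e_1+e_2+e_3\le(a,b,c)$ coordinatewise and time of $p$ at least $m$. A unit square face of $\mathbb Z^3$ is regarded as a lozenge with vertices (bottom, left, right, top): $$X_p=(p+e_2,\;p,\;p+e_2+e_3,\;p+e_3),\quad Y_p=(p+e_1,\;p+e_1+e_3,\;p,\;p+e_3),\quad Z_p=(p+e_1+e_2,\;p+e_1,\;p+e_2,\;p).$$ The cube $p$ has bottom faces $X_p,Y_p,Z_p$ and top faces $X_{p+e_1},Y_{p+e_2},Z_{p+e_3}$. The *augmented shadow* $\mathcal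 S_{a,b,c}$ consists of the bottom faces of the $\binom{N+1}{2}$ cubes of $Q_N$ at time $m$, i.e. the part of the flat surface at times $m,m+1,m+2$ inside the cube corner with apex $(a,b,c)$, completed at its top by the triangle of $\binom N2$ lozenges $Z_{(x,y,c)}$, $x\ge a-N$, $y\ge b-N$, $x+y+c\le m$. An *intermediate surface* with set of added cubes $\Lambda$ is a set of lozenges obtained from $\mathcal S_{a,b,c}$ by successively adding the cubes of $\Lambda$: a cube may be added when its three bottom faces belong to the surface, and these are then replaced by its three top faces. **Matrices.** Let the vertices $p$ carry labels $\tau_p\in A^\times$. Set $V(u,v,w)=\begin{pmatrix} v/w & u/w\\ 0&1\end{pmatrix}$, and let $V_i(u,v,w)$ be the $3N\times 3N$ identity matrix with the block in rows and columns $i,i+1$ replaced by $V(u,v,w)$. The level of $(x,y,z)$ is $z-x-y-(c-N-a-b)$. A lozenge with bottom, left, right vertices $u,v,w$ contributes $V_i(\tau_u,\tau_v,\tau_w)$, where $i$ is the common level of $v$ and $w$. A lozenge $L$ is immediately to the left of $L'$ if one of its edges bottom–right, right–top is one of the edges bottom–left, left–top of $L'$ (with the same lower and upper endpoints). A *reading*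 of a surface is a list of all its lozenges, each once, in which no lozenge comes after one that it is immediately to the left of. $M$ denotes the product of the matrices in the order of a reading. **Borders.** The West border of $\mathcal S_{a,b,c}$, from bottom to top, has vertices $w_1,\dots,w_{3N+1}$, where $w_i=(a,\,b-\lfloor i/2\rfloor,\,c-N+\lfloor (i-1)/2\rfloor)$ for $i\le 2N+1$ and $w_i=(a-(i-2N-1),\,b-N,\,c)$ for $i>2N+1$. The East border vertices $w'_j$ are $w'_j=(a-\lfloor j/2\rfloor,\,b,\,c-N+\lfloor (j-1)/2\rfloor)$ for $j\le 2N+1$ and $w'_j=(a-N,\,b-(j-2N-1),\,c)$ for $j>2N+1$. **Statement.** (1) Let $N\ge1$ and let $F$ be an intermediate surface with set of added cubes $\Lambda$. Then $F$ has a reading. Let moreover $\theta:\mathbb Z^3\to A^\times$ satisfy the cube relation at every cube of $Q_N\setminus\Lambda$ (the cubes above the surface, so that the values of $\theta$ on $F$ are arbitrary initial data), and let the labels satisfy $\tau_p=\theta_p$ at all points of time at least $m$; the labels at the vertices of the top triangle of time less than $m$ are arbitrary. Then, for every reading of $F$, $$\theta_{a,b,c}=\Big(\prod_{i=N+2}^{2N}\tau_{w_i}^{-1}\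 \prod_{j=2N+1}^{3N}\tau_{w'_j}\Big)\,\big|M\big|_{N+1,\dots,2N}^{2N+1,\dots,3N},$$ the minor of $M$ with rows $N+1,\dots,2N$ and columns $2N+1,\dots,3N$. (2) This covers arbitrary evaporated configurations. Let $G$ be obtained from the surface of the infinite cube corner with apex $(a,b,c)$ (the faces $X_{(a,y,z)}$ with $y<b,\,z<c$; $Y_{(x,b,z)}$ with $x<a,\,z<c$; $Z_{(x,y,c)}$ with $x<a,\,y<b$) by successively evaporating finitely many unit cubes, an evaporation replacing the three top faces of a cube by its three bottom faces, and let $E$ be the set of evaporated cubes. Then for all sufficiently large $N$ one has $E\subseteq Q_N$, and there is an intermediate surface with set of added cubes $Q_N\setminus E$ all of whose lozenges belong to $G$. -/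

import Mathlib

namespace CubeCorner

/-- Points of the cubic lattice. -/
abbrev Pt : Type := ℤ × ℤ × ℤ

def e1 : Pt := (1, 0, 0)
def e2 : Pt := (0, 1, 0)
def e3 : Pt := (0, 0, 1)

/-- The time of a lattice point, its component along `(1, 1, 1)`. -/
def time (p : Pt) : ℤ := p.1 + p.2.1 + p.2.2

/-- The evolution equation attached to the unit cube with bottom vertex `p`
and top vertex `p + e1 + e2 + e3`. -/
def CubeRelation {A : Type*} [CommRing A] (θ : Pt → Aˣ) (p : Pt) : Prop :=
  (θ p : A) * θ (p + e1 + e2 + e3) =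
    (θ (p + e1) : A) * θ (p + e2 + e3) + (θ (p + e2) : A) * θ (p + e1 + e3)

/-! ### Lozenges

In the projection along `(1, 1, 1)`, with `e3` drawn upwards, `e1` to the lower left and `e2` to
the lower right, every unit square face of the cubic lattice becomes a lozenge. Its horizontal
diagonal joins `left` to `right`; the gray triangle `bottom, left, right` lies below it and the
white triangle `left, right, top` above it. -/

/-- A lozenge, given by its four vertices. -/
@[ext]
structure Lozenge where
  bottom : Pt
  left : Pt
  right : Pt
  top : Pt

/-- The unit face `p, p + e2, p + e3, p + e2 + e3`. -/
def faceX (p : Pt) : Lozenge := ⟨p + e2, p, p + e2 + e3, p + e3⟩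

/-- The unit face `p, p + e1, p + e3, p + e1 + e3`. -/
def faceY (p : Pt) : Lozenge := ⟨p + e1, p + e1 + e3, p, p + e3⟩

/-- The unit face `p, p + e1, p + e2, p + e1 + e2`. -/
def faceZ (p : Pt) : Lozenge := ⟨p + e1 + e2, p + e1, p + e2, p⟩

/-- The three faces, at its bottom vertex `p`, of the unit cube with bottom vertex `p`. -/
def bottomFaces (p : Pt) : Set Lozenge := {faceX p, faceY p, faceZ p}

/-- The three faces, at its top vertex `p + e1 + e2 + e3`, of the unit cube with bottom
vertex `p`. -/
def topFaces (p : Pt) : Set Lozenge := {faceX (p + e1), faceY (p + e2), faceZ (p + e3)}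

/-! ### The augmented shadow and cube additions

The apex is `(a, b, c)`. The flat surface consists of the lattice points at the three consecutive
times `m, m + 1, m + 2`, where `m = a + b + c - 2 - N` is `baseTime a b c N`; thus `m = 0` exactly
when `N = a + b + c - 2`. -/

/-- The lowest time of the flat surface. -/
def baseTime (a b c : ℤ) (N : ℕ) : ℤ := a + b + c - 2 - N

/-- The unit cubes (given by their bottom vertices) that lie between the flat surface and the
surface of the cube corner with apex `(a, b, c)`. -/
def cubes (a b c : ℤ) (N : ℕ) : Set Pt :=
  {p | baseTime a b c N ≤ time p ∧ p.1 + 1 ≤ a ∧ p.2.1 + 1 ≤ b ∧ p.2.2 + 1 ≤ c}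

/-- The shadow of `(a, b, c)` on the flat surface: `N (N + 1) / 2` hexagons, each made of the
bottom faces of a cube. -/
def shadow (a b c : ℤ) (N : ℕ) : Set Lozenge :=
  {L | ∃ p ∈ cubes a b c N, time p = baseTime a b c N ∧ L ∈ bottomFaces p}

/-- The triangle of `N (N - 1) / 2` lozenges that completes the shadow at its top: rows of
`N - 1, N - 2, …, 1` lozenges with vertical long axis. All of them are placed in the plane
`z = c`. Their vertices at times below `baseTime a b c N` are not on the flat surface and only
serve as names for the corresponding points of the projection. -/
def topTriangle (a b c : ℤ) (N : ℕ) : Set Lozenge :=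
  {L | ∃ x y : ℤ, a - N ≤ x ∧ b - N ≤ y ∧ x + y + c ≤ baseTime a b c N ∧ L = faceZ (x, y, c)}

/-- The augmented shadow. -/
def augmentedShadow (a b c : ℤ) (N : ℕ) : Set Lozenge := shadow a b c N ∪ topTriangle a b c N

/-- `IntermediateSurface a b c N Λ F`: the surface with set of lozenges `F` is obtained from the
augmented shadow by successively adding unit cubes, `Λ` being the set of the cubes added.
A cube can be added where the surface contains its three bottom faces, and they are then
replaced by its three top faces. -/
inductive IntermediateSurface (a b c : ℤ) (N : ℕ) : Set Pt → Set Lozenge → Prop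
  | flat : IntermediateSurface a b c N ∅ (augmentedShadow a b c N)
  | add {Λ : Set Pt} {F : Set Lozenge} {p : Pt} :
      IntermediateSurface a b c N Λ F → bottomFaces p ⊆ F →
      IntermediateSurface a b c N (insert p Λ) ((F \ bottomFaces p) ∪ topFaces p)

/-- The surface of the infinite cube corner with apex `(a, b, c)`. -/
def cornerSurface (a b c : ℤ) : Set Lozenge :=
  {L | (∃ y z : ℤ, y < b ∧ z < c ∧ L = faceX (a, y, z)) ∨
       (∃ x z : ℤ, x < a ∧ z < c ∧ L = faceY (x, b, z)) ∨
       (∃ x y : ℤ, x < a ∧ y < b ∧ L = faceZ (x, y, c))}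

/-- `Evaporated a b c E G`: the surface `G` is obtained from the surface of the cube corner by
successively evaporating finitely many unit cubes, `E` being the set of the evaporated cubes. -/
inductive Evaporated (a b c : ℤ) : Set Pt → Set Lozenge → Prop
  | corner : Evaporated a b c ∅ (cornerSurface a b c)
  | melt {E : Set Pt} {G : Set Lozenge} {p : Pt} :
      Evaporated a b c E G → topFaces p ⊆ G →
      Evaporated a b c (insert p E) ((G \ topFaces p) ∪ bottomFaces p)

/-! ### The matrix of a surface -/

/-- The two edges on the left side of a lozenge, oriented upwards. -/
def leftEdges (L : Lozenge) : Set (Pt × Pt) := {(L.bottom, L.left), (L.left, L.top)}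

/-- The two edges on the right side of a lozenge, oriented upwards. -/
def rightEdges (L : Lozenge) : Set (Pt × Pt) := {(L.bottom, L.right), (L.right, L.top)}

/-- `L` is immediately to the left of `L'`. -/
def LeftOf (L L' : Lozenge) : Prop := (rightEdges L ∩ leftEdges L').Nonempty

/-- `l` lists the lozenges of `F`, each once, from left to right. -/
def IsReading (F : Set Lozenge) (l : List Lozenge) : Prop :=
  l.Nodup ∧ (∀ L, L ∈ l ↔ L ∈ F) ∧ l.Pairwise (fun L L' => ¬ LeftOf L' L)

/-- The `2 × 2` matrix `V(u, v, w)`. -/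
def V {A : Type*} [CommRing A] (u v w : Aˣ) : Matrix (Fin 2) (Fin 2) A :=
  !![((v / w : Aˣ) : A), ((u / w : Aˣ) : A); 0, 1]

/-- The `n × n` matrix equal to the identity except for the block `M` at the rows and columns
labeled `i, i + 1`. Labels run from `1` to `n`, so that `r : Fin n` has label `r + 1`. -/
def embed {A : Type*} [CommRing A] (n : ℕ) (i : ℤ) (M : Matrix (Fin 2) (Fin 2) A) :
    Matrix (Fin n) (Fin n) A :=
  Matrix.of fun r s =>
    if (r : ℤ) + 1 = i ∧ (s : ℤ) + 1 = i then M 0 0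
    else if (r : ℤ) + 1 = i ∧ (s : ℤ) + 1 = i + 1 then M 0 1
    else if (r : ℤ) + 1 = i + 1 ∧ (s : ℤ) + 1 = i then M 1 0
    else if (r : ℤ) + 1 = i + 1 ∧ (s : ℤ) + 1 = i + 1 then M 1 1
    else if r = s then 1 else 0

/-- The level of a vertex in the strip picture, counted from the bottom vertex `(a, b, c - N)` of
the augmented shadow. Along each edge of a lozenge it goes up by one. -/
def level (a b c : ℤ) (N : ℕ) (p : Pt) : ℤ := (p.2.2 - p.1 - p.2.1) - (c - N - a - b)

/-- The matrix `V_i` of a lozenge with vertex labels `τ`; `i` is the level of its horizontal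
diagonal. -/
def lozengeMatrix {A : Type*} [CommRing A] (a b c : ℤ) (N : ℕ) (τ : Pt → Aˣ) (L : Lozenge) :
    Matrix (Fin (3 * N)) (Fin (3 * N)) A :=
  embed (3 * N) (level a b c N L.left) (V (τ L.bottom) (τ L.left) (τ L.right))

/-- The product, from left to right, of the matrices of the lozenges in a list. -/
def readingMatrix {A : Type*} [CommRing A] (a b c : ℤ) (N : ℕ) (τ : Pt → Aˣ) (l : List Lozenge) :
    Matrix (Fin (3 * N)) (Fin (3 * N)) A :=
  (l.map (lozengeMatrix a b c N τ)).prod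

/-- The minor with rows `N + 1, …, 2 N` and columns `2 N + 1, …, 3 N`. -/
def cornerMinor {A : Type*} [CommRing A] (N : ℕ) (M : Matrix (Fin (3 * N)) (Fin (3 * N)) A) : A :=
  (M.submatrix (fun r : Fin N => (⟨N + r, by omega⟩ : Fin (3 * N)))
    (fun s : Fin N => (⟨2 * N + s, by omega⟩ : Fin (3 * N)))).det

/-- The `i`-th vertex, `1 ≤ i ≤ 3 N + 1`, of the West border of the augmented shadow, read from
bottom to top. -/
def west (a b c : ℤ) (N : ℕ) (i : ℕ) : Pt :=
  if i ≤ 2 * N + 1 then (a, b - (i : ℤ) / 2, c - N + ((i : ℤ) - 1) / 2)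
  else (a - ((i : ℤ) - (2 * N + 1)), b - N, c)

/-- The `j`-th vertex, `1 ≤ j ≤ 3 N + 1`, of the East border of the augmented shadow, read from
bottom to top. -/
def east (a b c : ℤ) (N : ℕ) (j : ℕ) : Pt :=
  if j ≤ 2 * N + 1 then (a - (j : ℤ) / 2, b, c - N + ((j : ℤ) - 1) / 2)
  else (a - N, b - ((j : ℤ) - (2 * N + 1)), c)

end CubeCorner

open CubeCorner

/-!
The left-to-right order on lozenges is acyclic (`LeftOf.key_lt`), so every surface has a reading.
A surface is determined by the pile `Λ` of the cubes below it (`surfaceOf`). It is a tiling: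
each edge is the left edge of at most one lozenge and the right edge of at most one lozenge, and
between two consecutive levels the lozenges form a chain from the West border to the East border. Hence
two lozenges whose matrices might not commute are comparable (`leftOfIn_total`), and all the readings
of a surface give the same product (`act_eq_of_isReading`).

A matrix `V_i` acts on a column by changing its entry `i` only. It is convenient to let it act on
sequences of vectors indexed by all the integers (`rowStep`, `act`), with no restriction on `i`.
In a reading of a surface to which a cube can be added, the three bottom faces can be brought together
by commutations; the cube relation is what makes their product `V_i V_{i-1} V_i` equal to
the product `V_{i-1} V_i V_{i-1}` of the top faces (`rowStep_cube`). Adding the cubes above the surface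
one by one, one may therefore replace the surface by that of the full cube corner
(`act_eq_act_cubes`).

There the faces of type `X`, those of the top rhombus and those of type `Y` can be read one group after
another. On the columns of the minor the `Y` faces act trivially, the rhombus produces a
lower triangular matrix (`act_zRows`), and each `X` face at a level above `N` multiplies the
determinant by a diagonal entry (`windowDet_act_cornerX`). All the products telescope to border
labels, and the prefactor leaves only the label of the apex (`apex_eq`).

For the second part, the evaporated cubes form an upper set of the corner, so the remaining cubes
of `Q_N` form a pile, and the faces of the surface above it are recognised as faces of the evaporated
configuration (`IsMelted.surfaceOf_subset`).
-/

namespace CubeCorner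

/-! ### Coordinates of the faces and acyclicity of the left-to-right relation -/

lemma add_e1 (x y z : ℤ) : ((x, y, z) : Pt) + e1 = (x + 1, y, z) := by simp [e1]
lemma add_e2 (x y z : ℤ) : ((x, y, z) : Pt) + e2 = (x, y + 1, z) := by simp [e2]
lemma add_e3 (x y z : ℤ) : ((x, y, z) : Pt) + e3 = (x, y, z + 1) := by simp [e3]

lemma faceX_mk (x y z : ℤ) :
    faceX (x, y, z) = ⟨(x, y + 1, z), (x, y, z), (x, y + 1, z + 1), (x, y, z + 1)⟩ := by
  simp [faceX, add_e2, add_e3]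
lemma faceY_mk (x y z : ℤ) :
    faceY (x, y, z) = ⟨(x + 1, y, z), (x + 1, y, z + 1), (x, y, z), (x, y, z + 1)⟩ := by
  simp [faceY, add_e1, add_e3]
lemma faceZ_mk (x y z : ℤ) :
    faceZ (x, y, z) = ⟨(x + 1, y + 1, z), (x + 1, y, z), (x, y + 1, z), (x, y, z)⟩ := by
  simp [faceZ, add_e1, add_e2]

lemma faceX_inj {p q : Pt} : faceX p = faceX q ↔ p = q :=
  ⟨fun h => congrArg Lozenge.left h, fun h => h ▸ rfl⟩
lemma faceY_inj {p q : Pt} : faceY p = faceY q ↔ p = q :=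
  ⟨fun h => congrArg Lozenge.right h, fun h => h ▸ rfl⟩
lemma faceZ_inj {p q : Pt} : faceZ p = faceZ q ↔ p = q :=
  ⟨fun h => congrArg Lozenge.top h, fun h => h ▸ rfl⟩

lemma faceX_ne_faceY (p q : Pt) : faceX p ≠ faceY q := by
  obtain ⟨x, y, z⟩ := p; obtain ⟨x', y', z'⟩ := q
  simp only [faceX_mk, faceY_mk, ne_eq, Lozenge.mk.injEq, Prod.mk.injEq]; omega
lemma faceX_ne_faceZ (p q : Pt) : faceX p ≠ faceZ q := by
  obtain ⟨x, y, z⟩ := p; obtain ⟨x', y', z'⟩ := q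
  simp only [faceX_mk, faceZ_mk, ne_eq, Lozenge.mk.injEq, Prod.mk.injEq]; omega
lemma faceY_ne_faceZ (p q : Pt) : faceY p ≠ faceZ q := by
  obtain ⟨x, y, z⟩ := p; obtain ⟨x', y', z'⟩ := q
  simp only [faceY_mk, faceZ_mk, ne_eq, Lozenge.mk.injEq, Prod.mk.injEq]; omega

/-- A lozenge is a face if it is one of the unit squares of the cubic lattice. -/
def IsFace (L : Lozenge) : Prop :=
  ∃ x y z : ℤ, L = faceX (x, y, z) ∨ L = faceY (x, y, z) ∨ L = faceZ (x, y, z)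

/-- A sort key that strictly increases from left to right. The first entry is (twice) the abscissa
`y - x` of the centre in the projection. It is constant exactly across the shared edges of stacks of
faces of type `X`, which are read upwards, and of type `Y`, which are read downwards; the second
entry breaks these ties. -/
def key (L : Lozenge) : ℤ ×ₗ ℤ :=
  toLex (L.left.2.1 - L.left.1 + (L.right.2.1 - L.right.1),
    (L.right.2.2 - L.left.2.2) * L.bottom.2.2)

lemma LeftOf.key_lt {L L' : Lozenge} (hL : IsFace L) (hL' : IsFace L') (h : LeftOf L L') :
    key L < key L' := by
  obtain ⟨e, he, he'⟩ := h
  obtain ⟨x, y, z, rfl | rfl | rfl⟩ := hL <;> obtain ⟨x', y', z', rfl | rfl | rfl⟩ := hL' <;>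
  · simp only [rightEdges, leftEdges, faceX_mk, faceY_mk, faceZ_mk, Set.mem_insert_iff,
      Set.mem_singleton_iff, Prod.ext_iff] at he he'
    simp only [key, faceX_mk, faceY_mk, faceZ_mk, Prod.Lex.toLex_lt_toLex]
    ring_nf
    omega

/-- A finite set of faces has a reading: sort it by the key. -/
lemma exists_isReading {F : Set Lozenge} (hF : F.Finite) (hface : ∀ L ∈ F, IsFace L) :
    ∃ l, IsReading F l := by
  classical
  let r : Lozenge → Lozenge → Prop := fun L L' => key L ≤ key L'
  have : Std.Total r := ⟨fun L L' => le_total _ _⟩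
  have : IsTrans Lozenge r := ⟨fun L L' L'' h h' => le_trans h h'⟩
  have hp := List.perm_insertionSort r hF.toFinset.toList
  have hm : ∀ L, L ∈ hF.toFinset.toList.insertionSort r ↔ L ∈ F := by simp [hp.mem_iff]
  refine ⟨hF.toFinset.toList.insertionSort r, hp.nodup_iff.2 (Finset.nodup_toList _), hm, ?_⟩
  refine (List.pairwise_insertionSort r _).imp_of_mem ?_
  intro L L' hL hL' h h'
  exact absurd (h'.key_lt (hface _ ((hm _).1 hL')) (hface _ ((hm _).1 hL))) (not_lt.2 h)

/-! ### Surfaces in terms of the cubes below them -/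

lemma mem_cubes {a b c : ℤ} {N : ℕ} {x y z : ℤ} : (x, y, z) ∈ cubes a b c N ↔
    a + b + c - 2 - N ≤ x + y + z ∧ x + 1 ≤ a ∧ y + 1 ≤ b ∧ z + 1 ≤ c := by
  simp [cubes, baseTime, time]

/-- A pile of cubes: a subset of `Q_N` that contains with a cube all the cubes of `Q_N`
immediately below it. -/
structure IsLowerPile (a b c : ℤ) (N : ℕ) (Λ : Set Pt) : Prop where
  subset : Λ ⊆ cubes a b c N
  lower : ∀ x y z, (x, y, z) ∈ cubes a b c N →
    (x + 1, y, z) ∈ Λ ∨ (x, y + 1, z) ∈ Λ ∨ (x, y, z + 1) ∈ Λ → (x, y, z) ∈ Λ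

/-- The cube with bottom vertex `(x, y, z)` belongs to the lowest layer of `Q_N`. -/
def IsBase (a b c : ℤ) (N : ℕ) (x y z : ℤ) : Prop :=
  x + y + z = a + b + c - 2 - N ∧ x + 1 ≤ a ∧ y + 1 ≤ b ∧ z + 1 ≤ c

/-- The face `Z_(x, y, z)` belongs to the triangle at the top of the augmented shadow. -/
def IsTop (a b c : ℤ) (N : ℕ) (x y z : ℤ) : Prop :=
  z = c ∧ a - N ≤ x ∧ b - N ≤ y ∧ x + y + z ≤ a + b + c - 2 - N

/-- The positions of the faces of type `X` on the surface above the pile of cubes `Λ`. -/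
def OnX (a b c : ℤ) (N : ℕ) (Λ : Set Pt) (x y z : ℤ) : Prop :=
  (x, y, z) ∉ Λ ∧ (IsBase a b c N x y z ∨ (x - 1, y, z) ∈ Λ)

/-- The positions of the faces of type `Y` on the surface above the pile of cubes `Λ`. -/
def OnY (a b c : ℤ) (N : ℕ) (Λ : Set Pt) (x y z : ℤ) : Prop :=
  (x, y, z) ∉ Λ ∧ (IsBase a b c N x y z ∨ (x, y - 1, z) ∈ Λ)

/-- The positions of the faces of type `Z` on the surface above the pile of cubes `Λ`. -/
def OnZ (a b c : ℤ) (N : ℕ) (Λ : Set Pt) (x y z : ℤ) : Prop :=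
  (x, y, z) ∉ Λ ∧ (IsBase a b c N x y z ∨ (x, y, z - 1) ∈ Λ ∨ IsTop a b c N x y z)

/-- The surface above the pile of cubes `Λ`: a face belongs to it if the cube above the face is not
in the pile, whereas the cube below it is in the pile or under the lowest layer. -/
def surfaceOf (a b c : ℤ) (N : ℕ) (Λ : Set Pt) : Set Lozenge :=
  {L | ∃ x y z : ℤ, (L = faceX (x, y, z) ∧ OnX a b c N Λ x y z) ∨
    (L = faceY (x, y, z) ∧ OnY a b c N Λ x y z) ∨ (L = faceZ (x, y, z) ∧ OnZ a b c N Λ x y z)}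

section
variable {a b c : ℤ} {N : ℕ} {Λ : Set Pt}

lemma faceX_mem_surfaceOf {x y z : ℤ} :
    faceX (x, y, z) ∈ surfaceOf a b c N Λ ↔ OnX a b c N Λ x y z := by
  constructor
  · rintro ⟨x', y', z', ⟨h, h'⟩ | ⟨h, -⟩ | ⟨h, -⟩⟩
    · cases faceX_inj.1 h; exact h'
    · exact absurd h (faceX_ne_faceY _ _)
    · exact absurd h (faceX_ne_faceZ _ _)
  · exact fun h => ⟨x, y, z, Or.inl ⟨rfl, h⟩⟩

lemma faceY_mem_surfaceOf {x y z : ℤ} :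
    faceY (x, y, z) ∈ surfaceOf a b c N Λ ↔ OnY a b c N Λ x y z := by
  constructor
  · rintro ⟨x', y', z', ⟨h, -⟩ | ⟨h, h'⟩ | ⟨h, -⟩⟩
    · exact absurd h.symm (faceX_ne_faceY _ _)
    · cases faceY_inj.1 h; exact h'
    · exact absurd h (faceY_ne_faceZ _ _)
  · exact fun h => ⟨x, y, z, Or.inr (Or.inl ⟨rfl, h⟩)⟩

lemma faceZ_mem_surfaceOf {x y z : ℤ} :
    faceZ (x, y, z) ∈ surfaceOf a b c N Λ ↔ OnZ a b c N Λ x y z := by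
  constructor
  · rintro ⟨x', y', z', ⟨h, -⟩ | ⟨h, -⟩ | ⟨h, h'⟩⟩
    · exact absurd h.symm (faceX_ne_faceZ _ _)
    · exact absurd h.symm (faceY_ne_faceZ _ _)
    · cases faceZ_inj.1 h; exact h'
  · exact fun h => ⟨x, y, z, Or.inr (Or.inr ⟨rfl, h⟩)⟩

lemma isFace_of_mem_surfaceOf {L : Lozenge} (h : L ∈ surfaceOf a b c N Λ) : IsFace L := by
  obtain ⟨x, y, z, ⟨rfl, -⟩ | ⟨rfl, -⟩ | ⟨rfl, -⟩⟩ := h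
  exacts [⟨x, y, z, Or.inl rfl⟩, ⟨x, y, z, Or.inr (Or.inl rfl)⟩, ⟨x, y, z, Or.inr (Or.inr rfl)⟩]

/-- Two sets of faces agree if they contain the same faces of each of the three types. -/
lemma ext_faces {S T : Set Lozenge} (hS : ∀ L ∈ S, IsFace L) (hT : ∀ L ∈ T, IsFace L)
    (hX : ∀ x y z, faceX (x, y, z) ∈ S ↔ faceX (x, y, z) ∈ T)
    (hY : ∀ x y z, faceY (x, y, z) ∈ S ↔ faceY (x, y, z) ∈ T)
    (hZ : ∀ x y z, faceZ (x, y, z) ∈ S ↔ faceZ (x, y, z) ∈ T) : S = T := by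
  ext L
  constructor <;> intro h
  · obtain ⟨x, y, z, rfl | rfl | rfl⟩ := hS L h
    exacts [(hX _ _ _).1 h, (hY _ _ _).1 h, (hZ _ _ _).1 h]
  · obtain ⟨x, y, z, rfl | rfl | rfl⟩ := hT L h
    exacts [(hX _ _ _).2 h, (hY _ _ _).2 h, (hZ _ _ _).2 h]

lemma mem_bottomFaces {p : Pt} {L : Lozenge} :
    L ∈ bottomFaces p ↔ L = faceX p ∨ L = faceY p ∨ L = faceZ p := by
  simp [bottomFaces]

lemma mem_topFaces {x y z : ℤ} {L : Lozenge} : L ∈ topFaces (x, y, z) ↔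
    L = faceX (x + 1, y, z) ∨ L = faceY (x, y + 1, z) ∨ L = faceZ (x, y, z + 1) := by
  simp [topFaces, add_e1, add_e2, add_e3]

lemma isFace_of_mem_topFaces {p : Pt} {L : Lozenge} (h : L ∈ topFaces p) : IsFace L := by
  obtain ⟨x, y, z⟩ := p
  obtain rfl | rfl | rfl := mem_topFaces.1 h
  exacts [⟨_, _, _, Or.inl rfl⟩, ⟨_, _, _, Or.inr (Or.inl rfl)⟩, ⟨_, _, _, Or.inr (Or.inr rfl)⟩]

lemma augmentedShadow_eq : augmentedShadow a b c N = surfaceOf a b c N ∅ := by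
  have hb : ∀ {x y z : ℤ}, ((x, y, z) ∈ cubes a b c N ∧ time (x, y, z) = baseTime a b c N) ↔
      IsBase a b c N x y z := by
    intro x y z
    simp only [mem_cubes, time, baseTime, IsBase]; omega
  ext L
  constructor
  · rintro (⟨⟨x, y, z⟩, hp, ht, hL⟩ | ⟨x, y, hx, hy, ht, rfl⟩)
    · have := hb.1 ⟨hp, ht⟩
      refine ⟨x, y, z, ?_⟩
      obtain rfl | rfl | rfl := mem_bottomFaces.1 hL <;> simp [OnX, OnY, OnZ, this]
    · simp only [baseTime] at ht
      exact ⟨x, y, c, Or.inr (Or.inr ⟨rfl, id, Or.inr (Or.inr ⟨rfl, hx, hy, ht⟩)⟩)⟩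
  · rintro ⟨x, y, z, ⟨rfl, -, h | h⟩ | ⟨rfl, -, h | h⟩ | ⟨rfl, -, h | h | ⟨rfl, hx, hy, ht⟩⟩⟩
    · exact Or.inl ⟨_, (hb.2 h).1, (hb.2 h).2, by simp [bottomFaces]⟩
    · exact h.elim
    · exact Or.inl ⟨_, (hb.2 h).1, (hb.2 h).2, by simp [bottomFaces]⟩
    · exact h.elim
    · exact Or.inl ⟨_, (hb.2 h).1, (hb.2 h).2, by simp [bottomFaces]⟩
    · exact h.elim
    · exact Or.inr ⟨x, y, hx, hy, ht, rfl⟩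

/-- A cube whose bottom faces are on the surface above a pile belongs to `Q_N`, even though this is
not part of the rule for adding cubes, and its addition gives another pile. -/
lemma IsLowerPile.of_bottomFaces_subset (h : IsLowerPile a b c N Λ) {x y z : ℤ}
    (hp : bottomFaces (x, y, z) ⊆ surfaceOf a b c N Λ) :
    (x, y, z) ∈ cubes a b c N ∧ (x, y, z) ∉ Λ ∧ IsLowerPile a b c N (insert (x, y, z) Λ) := by
  have hX := faceX_mem_surfaceOf.1 (hp (mem_bottomFaces.2 (Or.inl rfl)))
  have hY := faceY_mem_surfaceOf.1 (hp (mem_bottomFaces.2 (Or.inr (Or.inl rfl))))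
  have hZ := faceZ_mem_surfaceOf.1 (hp (mem_bottomFaces.2 (Or.inr (Or.inr rfl))))
  have hmem : (x, y, z) ∈ cubes a b c N := by
    obtain ⟨-, h1⟩ := hX
    obtain ⟨-, h2⟩ := hY
    rw [mem_cubes]
    obtain h1 | h1 := h1
    · simp only [IsBase] at h1; omega
    obtain h2 | h2 := h2
    · simp only [IsBase] at h2; omega
    have h1 := mem_cubes.1 (h.subset h1)
    have h2 := mem_cubes.1 (h.subset h2)
    omega
  refine ⟨hmem, hX.1, Set.insert_subset hmem h.subset, ?_⟩
  intro x' y' z' hq hor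
  simp only [Set.mem_insert_iff, Prod.mk.injEq] at hor ⊢
  have hq' := mem_cubes.1 hq
  obtain (⟨rfl, rfl, rfl⟩ | h1) | (⟨rfl, rfl, rfl⟩ | h1) | (⟨rfl, rfl, rfl⟩ | h1) := hor
  · obtain h2 | h2 := hX.2
    · simp only [IsBase] at h2; omega
    · rw [show x' + 1 - 1 = x' by ring] at h2; exact Or.inr h2
  · exact Or.inr (h.lower _ _ _ hq (Or.inl h1))
  · obtain h2 | h2 := hY.2
    · simp only [IsBase] at h2; omega
    · rw [show y' + 1 - 1 = y' by ring] at h2; exact Or.inr h2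
  · exact Or.inr (h.lower _ _ _ hq (Or.inr (Or.inl h1)))
  · obtain h2 | h2 | h2 := hZ.2
    · simp only [IsBase] at h2; omega
    · rw [show z' + 1 - 1 = z' by ring] at h2; exact Or.inr h2
    · have := mem_cubes.1 hmem; simp only [IsTop] at h2; omega
  · exact Or.inr (h.lower _ _ _ hq (Or.inr (Or.inr h1)))

lemma IsLowerPile.notMem_above (h : IsLowerPile a b c N Λ) {x y z : ℤ}
    (hp : (x, y, z) ∈ cubes a b c N) (hn : (x, y, z) ∉ Λ) :
    (x + 1, y, z) ∉ Λ ∧ (x, y + 1, z) ∉ Λ ∧ (x, y, z + 1) ∉ Λ :=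
  ⟨fun h' => hn (h.lower _ _ _ hp (Or.inl h')), fun h' => hn (h.lower _ _ _ hp (Or.inr (Or.inl h'))),
    fun h' => hn (h.lower _ _ _ hp (Or.inr (Or.inr h')))⟩

lemma surfaceOf_insert (h : IsLowerPile a b c N Λ) {x y z : ℤ}
    (hp : (x, y, z) ∈ cubes a b c N) (hn : (x, y, z) ∉ Λ) :
    (surfaceOf a b c N Λ \ bottomFaces (x, y, z)) ∪ topFaces (x, y, z) =
      surfaceOf a b c N (insert (x, y, z) Λ) := by
  have hab := h.notMem_above hp hn
  apply ext_faces
  · rintro L (hL | hL)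
    exacts [isFace_of_mem_surfaceOf hL.1, isFace_of_mem_topFaces hL]
  · exact fun L => isFace_of_mem_surfaceOf
  · intro x' y' z'
    simp only [Set.mem_union, Set.mem_sdiff, faceX_mem_surfaceOf, mem_bottomFaces, mem_topFaces,
      faceX_inj, faceX_ne_faceY, faceX_ne_faceZ, OnX, Set.mem_insert_iff, or_false]
    by_cases e : (x', y', z') = (x + 1, y, z)
    · cases e
      simp [hab.1]
    · have e' : (x' - 1, y', z') ≠ (x, y, z) := by
        simp only [ne_eq, Prod.mk.injEq] at e ⊢; omega
      simp only [e, e']; tauto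
  · intro x' y' z'
    simp only [Set.mem_union, Set.mem_sdiff, faceY_mem_surfaceOf, mem_bottomFaces, mem_topFaces,
      faceY_inj, (faceX_ne_faceY _ _).symm, faceY_ne_faceZ, OnY, Set.mem_insert_iff, or_false,
      false_or]
    by_cases e : (x', y', z') = (x, y + 1, z)
    · cases e
      simp [hab.2.1]
    · have e' : (x', y' - 1, z') ≠ (x, y, z) := by
        simp only [ne_eq, Prod.mk.injEq] at e ⊢; omega
      simp only [e, e']; tauto
  · intro x' y' z'
    simp only [Set.mem_union, Set.mem_sdiff, faceZ_mem_surfaceOf, mem_bottomFaces, mem_topFaces,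
      faceZ_inj, (faceX_ne_faceZ _ _).symm, (faceY_ne_faceZ _ _).symm, OnZ, Set.mem_insert_iff,
      false_or]
    by_cases e : (x', y', z') = (x, y, z + 1)
    · cases e
      simp [hab.2.2]
    · have e' : (x', y', z' - 1) ≠ (x, y, z) := by
        simp only [ne_eq, Prod.mk.injEq] at e ⊢; omega
      simp only [e, e']; tauto

lemma isLowerPile_empty : IsLowerPile a b c N ∅ :=
  ⟨Set.empty_subset _, fun _ _ _ _ h => by simp at h⟩

/-- An intermediate surface is the surface above the pile of the cubes added. -/
lemma IntermediateSurface.eq_surfaceOf {F : Set Lozenge} (h : IntermediateSurface a b c N Λ F) :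
    IsLowerPile a b c N Λ ∧ F = surfaceOf a b c N Λ := by
  induction h with
  | flat => exact ⟨isLowerPile_empty, augmentedShadow_eq⟩
  | @add Λ F p hF hp ih =>
    obtain ⟨hΛ, rfl⟩ := ih
    obtain ⟨x, y, z⟩ := p
    obtain ⟨h1, h2, h3⟩ := hΛ.of_bottomFaces_subset hp
    exact ⟨h3, surfaceOf_insert hΛ h1 h2⟩

lemma finite_cubes (a b c : ℤ) (N : ℕ) : (cubes a b c N).Finite := by
  refine (((Set.finite_Icc (a - N - 1) a).prod ((Set.finite_Icc (b - N - 1) b).prod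
    (Set.finite_Icc (c - N - 1) c))).subset ?_)
  rintro ⟨x, y, z⟩ h
  have := mem_cubes.1 h
  simp only [Set.mem_prod, Set.mem_Icc]
  omega

lemma finite_surfaceOf (h : IsLowerPile a b c N Λ) : (surfaceOf a b c N Λ).Finite := by
  let B : Set Pt := Set.Icc (a - N - 1) a ×ˢ (Set.Icc (b - N - 1) b ×ˢ Set.Icc (c - N - 1) c)
  have hB : B.Finite := (Set.finite_Icc _ _).prod ((Set.finite_Icc _ _).prod (Set.finite_Icc _ _))
  refine ((hB.image faceX).union ((hB.image faceY).union (hB.image faceZ))).subset ?_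
  have hs : ∀ {x y z : ℤ}, (x, y, z) ∈ Λ → _ := fun h' => mem_cubes.1 (h.subset h')
  rintro L ⟨x, y, z, ⟨rfl, -, h1⟩ | ⟨rfl, -, h1⟩ | ⟨rfl, -, h1⟩⟩
  · refine Or.inl ⟨_, ?_, rfl⟩
    simp only [B, Set.mem_prod, Set.mem_Icc]
    obtain h1 | h1 := h1
    · simp only [IsBase] at h1; omega
    · have := hs h1; omega
  · refine Or.inr (Or.inl ⟨_, ?_, rfl⟩)
    simp only [B, Set.mem_prod, Set.mem_Icc]
    obtain h1 | h1 := h1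
    · simp only [IsBase] at h1; omega
    · have := hs h1; omega
  · refine Or.inr (Or.inr ⟨_, ?_, rfl⟩)
    simp only [B, Set.mem_prod, Set.mem_Icc]
    obtain h1 | h1 | h1 := h1
    · simp only [IsBase] at h1; omega
    · have := hs h1; omega
    · simp only [IsTop] at h1; omega

/-- A pile that is not all of `Q_N` leaves room for a further cube: a missing cube of least
time. -/
lemma exists_addable (hne : ∃ p ∈ cubes a b c N, p ∉ Λ) :
    ∃ p ∈ cubes a b c N, p ∉ Λ ∧ bottomFaces p ⊆ surfaceOf a b c N Λ := by
  obtain ⟨⟨x, y, z⟩, ⟨hp, hn⟩, hmin⟩ := Set.exists_min_image (cubes a b c N \ Λ) time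
    ((finite_cubes a b c N).subset Set.sdiff_subset) (by obtain ⟨p, h1, h2⟩ := hne; exact ⟨p, h1, h2⟩)
  have hp' := mem_cubes.1 hp
  have hb : ∀ x' y' z', (x', y', z') ∈ cubes a b c N → x' + y' + z' < x + y + z →
      (x', y', z') ∈ Λ := by
    intro x' y' z' hq hlt
    by_contra hcon
    have := hmin _ ⟨hq, hcon⟩
    simp only [time] at this
    omega
  refine ⟨_, hp, hn, ?_⟩
  intro L hL
  by_cases hbase : IsBase a b c N x y z
  · obtain rfl | rfl | rfl := mem_bottomFaces.1 hL
    exacts [faceX_mem_surfaceOf.2 ⟨hn, Or.inl hbase⟩, faceY_mem_surfaceOf.2 ⟨hn, Or.inl hbase⟩,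
      faceZ_mem_surfaceOf.2 ⟨hn, Or.inl hbase⟩]
  · simp only [IsBase] at hbase
    obtain rfl | rfl | rfl := mem_bottomFaces.1 hL
    · exact faceX_mem_surfaceOf.2 ⟨hn, Or.inr (hb _ _ _ (mem_cubes.2 (by omega)) (by omega))⟩
    · exact faceY_mem_surfaceOf.2 ⟨hn, Or.inr (hb _ _ _ (mem_cubes.2 (by omega)) (by omega))⟩
    · exact faceZ_mem_surfaceOf.2
        ⟨hn, Or.inr (Or.inl (hb _ _ _ (mem_cubes.2 (by omega)) (by omega)))⟩


end

/-! ### Strips: the surface as a tiling -/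

section
variable {a b c : ℤ} {N : ℕ} {Λ : Set Pt}

lemma mem_leftEdges_faceX {x y z : ℤ} {e : Pt × Pt} : e ∈ leftEdges (faceX (x, y, z)) ↔
    e = ((x, y + 1, z), (x, y, z)) ∨ e = ((x, y, z), (x, y, z + 1)) := by
  simp [leftEdges, faceX_mk]
lemma mem_leftEdges_faceY {x y z : ℤ} {e : Pt × Pt} : e ∈ leftEdges (faceY (x, y, z)) ↔
    e = ((x + 1, y, z), (x + 1, y, z + 1)) ∨ e = ((x + 1, y, z + 1), (x, y, z + 1)) := by
  simp [leftEdges, faceY_mk]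
lemma mem_leftEdges_faceZ {x y z : ℤ} {e : Pt × Pt} : e ∈ leftEdges (faceZ (x, y, z)) ↔
    e = ((x + 1, y + 1, z), (x + 1, y, z)) ∨ e = ((x + 1, y, z), (x, y, z)) := by
  simp [leftEdges, faceZ_mk]
lemma mem_rightEdges_faceX {x y z : ℤ} {e : Pt × Pt} : e ∈ rightEdges (faceX (x, y, z)) ↔
    e = ((x, y + 1, z), (x, y + 1, z + 1)) ∨ e = ((x, y + 1, z + 1), (x, y, z + 1)) := by
  simp [rightEdges, faceX_mk]
lemma mem_rightEdges_faceY {x y z : ℤ} {e : Pt × Pt} : e ∈ rightEdges (faceY (x, y, z)) ↔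
    e = ((x + 1, y, z), (x, y, z)) ∨ e = ((x, y, z), (x, y, z + 1)) := by
  simp [rightEdges, faceY_mk]
lemma mem_rightEdges_faceZ {x y z : ℤ} {e : Pt × Pt} : e ∈ rightEdges (faceZ (x, y, z)) ↔
    e = ((x + 1, y + 1, z), (x, y + 1, z)) ∨ e = ((x, y + 1, z), (x, y, z)) := by
  simp [rightEdges, faceZ_mk]

lemma OnX.time_le (h : IsLowerPile a b c N Λ) {x y z : ℤ} (hX : OnX a b c N Λ x y z) :
    a + b + c - 2 - N ≤ x + y + z ∧ x ≤ a ∧ y + 1 ≤ b ∧ z + 1 ≤ c := by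
  obtain ⟨-, h1 | h1⟩ := hX
  · simp only [IsBase] at h1; omega
  · have := mem_cubes.1 (h.subset h1); omega

lemma OnY.time_le (h : IsLowerPile a b c N Λ) {x y z : ℤ} (hY : OnY a b c N Λ x y z) :
    a + b + c - 2 - N ≤ x + y + z ∧ x + 1 ≤ a ∧ y ≤ b ∧ z + 1 ≤ c := by
  obtain ⟨-, h1 | h1⟩ := hY
  · simp only [IsBase] at h1; omega
  · have := mem_cubes.1 (h.subset h1); omega

lemma OnZ.time_le (h : IsLowerPile a b c N Λ) {x y z : ℤ} (hZ : OnZ a b c N Λ x y z) :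
    (a + b + c - 2 - N ≤ x + y + z ∨ IsTop a b c N x y z) ∧ x + 1 ≤ a ∧ y + 1 ≤ b ∧ z ≤ c := by
  obtain ⟨-, h1 | h1 | h1⟩ := hZ
  · simp only [IsBase] at h1; omega
  · have := mem_cubes.1 (h.subset h1); omega
  · have h2 := h1
    simp only [IsTop] at h2
    exact ⟨Or.inr h1, by omega⟩

lemma OnX.mem_of_time_le {x y z : ℤ} (hX : OnX a b c N Λ x y z)
    (ht : a + b + c - 2 - N < x + y + z) : (x - 1, y, z) ∈ Λ := by
  obtain ⟨-, h1 | h1⟩ := hX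
  · simp only [IsBase] at h1; omega
  · exact h1

lemma OnY.mem_of_time_le {x y z : ℤ} (hY : OnY a b c N Λ x y z)
    (ht : a + b + c - 2 - N < x + y + z) : (x, y - 1, z) ∈ Λ := by
  obtain ⟨-, h1 | h1⟩ := hY
  · simp only [IsBase] at h1; omega
  · exact h1

lemma OnZ.mem_of_time_le {x y z : ℤ} (hZ : OnZ a b c N Λ x y z)
    (ht : a + b + c - 2 - N < x + y + z) : (x, y, z - 1) ∈ Λ := by
  obtain ⟨-, h1 | h1 | h1⟩ := hZ
  · simp only [IsBase] at h1; omega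
  · exact h1
  · simp only [IsTop] at h1; omega

/-- An edge of a surface is a left edge of at most one lozenge. -/
lemma left_unique (h : IsLowerPile a b c N Λ) {L L' : Lozenge} {e : Pt × Pt}
    (hL : L ∈ surfaceOf a b c N Λ) (hL' : L' ∈ surfaceOf a b c N Λ)
    (he : e ∈ leftEdges L) (he' : e ∈ leftEdges L') : L = L' := by
  -- Two faces with a common left edge that differ would be a face of a cube above it and a face
  -- of the same cube below it.
  have hXY : ∀ x y z, OnX a b c N Λ (x + 1) y z → OnY a b c N Λ x y z → False := by
    intro x y z h1 h2
    have := h1.mem_of_time_le (by have := h2.time_le h; omega)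
    rw [add_sub_cancel_right] at this
    exact h2.1 this
  have hXZ : ∀ x y z, OnX a b c N Λ (x + 1) y z → OnZ a b c N Λ x y z → False := by
    intro x y z h1 h2
    have h3 := h1.time_le h
    have := h1.mem_of_time_le (by have := h2.time_le h; simp only [IsTop] at this; omega)
    rw [add_sub_cancel_right] at this
    exact h2.1 this
  have hYZ : ∀ x y z, OnY a b c N Λ x y z → OnZ a b c N Λ x y (z + 1) → False := by
    intro x y z h1 h2
    have := h2.mem_of_time_le (by have := h1.time_le h; omega)
    rw [add_sub_cancel_right] at this
    exact h1.1 this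
  obtain ⟨x, y, z, ⟨rfl, h1⟩ | ⟨rfl, h1⟩ | ⟨rfl, h1⟩⟩ := hL <;>
  obtain ⟨x', y', z', ⟨rfl, h1'⟩ | ⟨rfl, h1'⟩ | ⟨rfl, h1'⟩⟩ := hL' <;>
  simp only [mem_leftEdges_faceX, mem_leftEdges_faceY, mem_leftEdges_faceZ, Prod.ext_iff] at he he'
  · obtain ⟨rfl, rfl, rfl⟩ : x' = x ∧ y' = y ∧ z' = z := by omega
    rfl
  · obtain ⟨rfl, rfl, rfl⟩ : x = x' + 1 ∧ y = y' ∧ z = z' := by omega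
    exact (hXY _ _ _ h1 h1').elim
  · obtain ⟨rfl, rfl, rfl⟩ : x = x' + 1 ∧ y = y' ∧ z = z' := by omega
    exact (hXZ _ _ _ h1 h1').elim
  · obtain ⟨rfl, rfl, rfl⟩ : x' = x + 1 ∧ y' = y ∧ z' = z := by omega
    exact (hXY _ _ _ h1' h1).elim
  · obtain ⟨rfl, rfl, rfl⟩ : x' = x ∧ y' = y ∧ z' = z := by omega
    rfl
  · obtain ⟨rfl, rfl, rfl⟩ : x' = x ∧ y' = y ∧ z' = z + 1 := by omega
    exact (hYZ _ _ _ h1 h1').elim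
  · obtain ⟨rfl, rfl, rfl⟩ : x' = x + 1 ∧ y' = y ∧ z' = z := by omega
    exact (hXZ _ _ _ h1' h1).elim
  · obtain ⟨rfl, rfl, rfl⟩ : x = x' ∧ y = y' ∧ z = z' + 1 := by omega
    exact (hYZ _ _ _ h1' h1).elim
  · obtain ⟨rfl, rfl, rfl⟩ : x' = x ∧ y' = y ∧ z' = z := by omega
    rfl

/-- An edge of a surface is a right edge of at most one lozenge. -/
lemma right_unique (h : IsLowerPile a b c N Λ) {L L' : Lozenge} {e : Pt × Pt}
    (hL : L ∈ surfaceOf a b c N Λ) (hL' : L' ∈ surfaceOf a b c N Λ)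
    (he : e ∈ rightEdges L) (he' : e ∈ rightEdges L') : L = L' := by
  have hXY : ∀ x y z, OnX a b c N Λ x y z → OnY a b c N Λ x (y + 1) z → False := by
    intro x y z h1 h2
    have := h2.mem_of_time_le (by have := h1.time_le h; omega)
    rw [add_sub_cancel_right] at this
    exact h1.1 this
  have hXZ : ∀ x y z, OnX a b c N Λ x y z → OnZ a b c N Λ x y (z + 1) → False := by
    intro x y z h1 h2
    have := h2.mem_of_time_le (by have := h1.time_le h; omega)
    rw [add_sub_cancel_right] at this
    exact h1.1 this
  have hYZ : ∀ x y z, OnY a b c N Λ x (y + 1) z → OnZ a b c N Λ x y z → False := by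
    intro x y z h1 h2
    have h3 := h1.time_le h
    have := h1.mem_of_time_le (by have := h2.time_le h; simp only [IsTop] at this; omega)
    rw [add_sub_cancel_right] at this
    exact h2.1 this
  obtain ⟨x, y, z, ⟨rfl, h1⟩ | ⟨rfl, h1⟩ | ⟨rfl, h1⟩⟩ := hL <;>
  obtain ⟨x', y', z', ⟨rfl, h1'⟩ | ⟨rfl, h1'⟩ | ⟨rfl, h1'⟩⟩ := hL' <;>
  simp only [mem_rightEdges_faceX, mem_rightEdges_faceY, mem_rightEdges_faceZ,
    Prod.ext_iff] at he he'
  · obtain ⟨rfl, rfl, rfl⟩ : x' = x ∧ y' = y ∧ z' = z := by omega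
    rfl
  · obtain ⟨rfl, rfl, rfl⟩ : x' = x ∧ y' = y + 1 ∧ z' = z := by omega
    exact (hXY _ _ _ h1 h1').elim
  · obtain ⟨rfl, rfl, rfl⟩ : x' = x ∧ y' = y ∧ z' = z + 1 := by omega
    exact (hXZ _ _ _ h1 h1').elim
  · obtain ⟨rfl, rfl, rfl⟩ : x = x' ∧ y = y' + 1 ∧ z = z' := by omega
    exact (hXY _ _ _ h1' h1).elim
  · obtain ⟨rfl, rfl, rfl⟩ : x' = x ∧ y' = y ∧ z' = z := by omega
    rfl
  · obtain ⟨rfl, rfl, rfl⟩ : x = x' ∧ y = y' + 1 ∧ z = z' := by omega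
    exact (hYZ _ _ _ h1 h1').elim
  · obtain ⟨rfl, rfl, rfl⟩ : x = x' ∧ y = y' ∧ z = z' + 1 := by omega
    exact (hXZ _ _ _ h1' h1).elim
  · obtain ⟨rfl, rfl, rfl⟩ : x' = x ∧ y' = y + 1 ∧ z' = z := by omega
    exact (hYZ _ _ _ h1' h1).elim
  · obtain ⟨rfl, rfl, rfl⟩ : x' = x ∧ y' = y ∧ z' = z := by omega
    rfl

/-- The oriented edges of the East border of the augmented shadow: those of the zigzag between the
times `m + 1` and `m + 2`, and those on the East side of the top triangle. -/
def EastEdge (a b c : ℤ) (N : ℕ) (e : Pt × Pt) : Prop :=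
  ∃ x y z : ℤ,
    (e = ((x, b, z), (x - 1, b, z)) ∧ x + b + z = a + b + c - N ∧ z + 1 ≤ c) ∨
    (e = ((x, b, z), (x, b, z + 1)) ∧ x + b + z = a + b + c - 1 - N ∧ z + 1 ≤ c) ∨
    (e = ((x, y, z), (x, y - 1, z)) ∧ x = a - N ∧ y ≤ b ∧ z = c)

lemma EastEdge.eq_of_level_eq {e e' : Pt × Pt} (h : EastEdge a b c N e) (h' : EastEdge a b c N e')
    (hl : level a b c N e.1 = level a b c N e'.1) : e = e' := by
  obtain ⟨x, y, z, ⟨rfl, h1⟩ | ⟨rfl, h1⟩ | ⟨rfl, h1⟩⟩ := h <;>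
  obtain ⟨x', y', z', ⟨rfl, h1'⟩ | ⟨rfl, h1'⟩ | ⟨rfl, h1'⟩⟩ := h' <;>
  · simp only [level] at hl
    simp only [Prod.mk.injEq, true_and]
    omega

/-- A surface continues to the right of each of its edges, up to the East border. -/
lemma exists_right_neighbour (h : IsLowerPile a b c N Λ) {L : Lozenge} {e : Pt × Pt}
    (hL : L ∈ surfaceOf a b c N Λ) (he : e ∈ rightEdges L) :
    (∃ L' ∈ surfaceOf a b c N Λ, e ∈ leftEdges L') ∨ EastEdge a b c N e := by
  have hcube : ∀ {x y z : ℤ}, (x, y, z) ∈ Λ → _ := fun h' => mem_cubes.1 (h.subset h')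
  have X : ∀ x y z, OnX a b c N Λ x y z →
      (e = ((x, y + 1, z), (x, y, z)) ∨ e = ((x, y, z), (x, y, z + 1))) →
      (∃ L' ∈ surfaceOf a b c N Λ, e ∈ leftEdges L') ∨ EastEdge a b c N e :=
    fun x y z h1 h2 => Or.inl ⟨_, faceX_mem_surfaceOf.2 h1, mem_leftEdges_faceX.2 h2⟩
  have Y : ∀ x y z, OnY a b c N Λ x y z →
      (e = ((x + 1, y, z), (x + 1, y, z + 1)) ∨ e = ((x + 1, y, z + 1), (x, y, z + 1))) →
      (∃ L' ∈ surfaceOf a b c N Λ, e ∈ leftEdges L') ∨ EastEdge a b c N e :=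
    fun x y z h1 h2 => Or.inl ⟨_, faceY_mem_surfaceOf.2 h1, mem_leftEdges_faceY.2 h2⟩
  have Z : ∀ x y z, OnZ a b c N Λ x y z →
      (e = ((x + 1, y + 1, z), (x + 1, y, z)) ∨ e = ((x + 1, y, z), (x, y, z))) →
      (∃ L' ∈ surfaceOf a b c N Λ, e ∈ leftEdges L') ∨ EastEdge a b c N e :=
    fun x y z h1 h2 => Or.inl ⟨_, faceZ_mem_surfaceOf.2 h1, mem_leftEdges_faceZ.2 h2⟩
  obtain ⟨x, y, z, ⟨rfl, h1⟩ | ⟨rfl, h1⟩ | ⟨rfl, h1⟩⟩ := hL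
  · have ht := h1.time_le h
    -- the cubes beside the cube above the given face are not in the pile either
    have hn : ∀ x' y' z', (x', y', z') = (x, y + 1, z) ∨ (x', y', z') = (x, y, z + 1) →
        (x', y', z') ∉ Λ := by
      intro x' y' z' hor hmem
      have h2 := hcube hmem
      have hQ : (x, y, z) ∈ cubes a b c N := mem_cubes.2 (by simp only [Prod.mk.injEq] at hor; omega)
      have h3 := h.notMem_above hQ h1.1
      obtain h4 | h4 := hor <;> rw [h4] at hmem
      exacts [h3.2.1 hmem, h3.2.2 hmem]
    obtain rfl | rfl := mem_rightEdges_faceX.1 he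
    · by_cases hq : (x - 1, y + 1, z) ∈ Λ
      · exact X x (y + 1) z ⟨hn _ _ _ (Or.inl rfl), Or.inr hq⟩ (by simp)
      · obtain h2 | h2 := h1.2
        · simp only [IsBase] at h2
          by_cases hy : y + 1 + 1 ≤ b
          · exact Y (x - 1) (y + 1) z ⟨hq, Or.inl (by simp only [IsBase]; omega)⟩ (by simp)
          · obtain rfl : b = y + 1 := by omega
            exact Or.inr ⟨x, 0, z, Or.inr (Or.inl ⟨rfl, by omega⟩)⟩
        · exact Y (x - 1) (y + 1) z ⟨hq, Or.inr (by simpa using h2)⟩ (by simp)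
    · by_cases hq : (x - 1, y, z + 1) ∈ Λ
      · exact X x y (z + 1) ⟨hn _ _ _ (Or.inr rfl), Or.inr hq⟩ (by simp)
      · obtain h2 | h2 := h1.2
        · simp only [IsBase] at h2
          by_cases hz : z + 1 + 1 ≤ c
          · exact Z (x - 1) y (z + 1) ⟨hq, Or.inl (by simp only [IsBase]; omega)⟩ (by simp)
          · by_cases hx : a - N ≤ x - 1
            · exact Z (x - 1) y (z + 1)
                ⟨hq, Or.inr (Or.inr (by simp only [IsTop]; omega))⟩ (by simp)
            · exact Or.inr ⟨x, y + 1, z + 1, Or.inr (Or.inr ⟨by simp, by omega⟩)⟩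
        · exact Z (x - 1) y (z + 1) ⟨hq, Or.inr (Or.inl (by simpa using h2))⟩ (by simp)
  · have ht := h1.time_le h
    obtain rfl | rfl := mem_rightEdges_faceY.1 he
    · by_cases hq : (x, y, z - 1) ∈ Λ
      · exact Z x y z ⟨h1.1, Or.inr (Or.inl hq)⟩ (by simp)
      · obtain h2 | h2 := h1.2
        · exact Z x y z ⟨h1.1, Or.inl h2⟩ (by simp)
        · have h3 := hcube h2
          by_cases ht' : a + b + c - 2 - N = x + y - 1 + z
          · by_cases hy : y + 1 ≤ b
            · exact Y x y (z - 1) ⟨hq, Or.inl (by simp only [IsBase]; omega)⟩ (by simp)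
            · obtain rfl : b = y := by omega
              exact Or.inr ⟨x + 1, 0, z, Or.inl ⟨by simp, by omega⟩⟩
          · exact Y x y (z - 1) ⟨hq, Or.inr (h.lower _ _ _ (mem_cubes.2 (by omega))
              (Or.inr (Or.inr (by simpa using h2))))⟩ (by simp)
    · by_cases hq : (x - 1, y, z) ∈ Λ
      · exact X x y z ⟨h1.1, Or.inr hq⟩ (by simp)
      · obtain h2 | h2 := h1.2
        · exact X x y z ⟨h1.1, Or.inl h2⟩ (by simp)
        · have h3 := hcube h2
          by_cases ht' : a + b + c - 2 - N = x + y - 1 + z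
          · by_cases hy : y + 1 ≤ b
            · exact Y (x - 1) y z ⟨hq, Or.inl (by simp only [IsBase]; omega)⟩ (by simp)
            · obtain rfl : b = y := by omega
              exact Or.inr ⟨x, 0, z, Or.inr (Or.inl ⟨rfl, by omega⟩)⟩
          · exact Y (x - 1) y z ⟨hq, Or.inr (h.lower _ _ _ (mem_cubes.2 (by omega))
              (Or.inl (by simpa using h2)))⟩ (by simp)
  · have ht := h1.time_le h
    have hn : ∀ x' y' z', (x', y', z') = (x, y + 1, z) → (x', y', z') ∉ Λ := by
      intro x' y' z' hor hmem
      have h2 := hcube hmem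
      simp only [IsTop] at ht
      have hQ : (x, y, z) ∈ cubes a b c N := mem_cubes.2 (by simp only [Prod.mk.injEq] at hor; omega)
      rw [hor] at hmem
      exact (h.notMem_above hQ h1.1).2.1 hmem
    obtain rfl | rfl := mem_rightEdges_faceZ.1 he
    · by_cases hq : (x, y + 1, z - 1) ∈ Λ
      · exact Z x (y + 1) z ⟨hn _ _ _ rfl, Or.inr (Or.inl hq)⟩ (by simp)
      · obtain h2 | h2 | h2 := h1.2
        · simp only [IsBase] at h2
          by_cases hy : y + 1 + 1 ≤ b
          · exact Y x (y + 1) (z - 1) ⟨hq, Or.inl (by simp only [IsBase]; omega)⟩ (by simp)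
          · obtain rfl : b = y + 1 := by omega
            exact Or.inr ⟨x + 1, 0, z, Or.inl ⟨by simp, by omega⟩⟩
        · exact Y x (y + 1) (z - 1) ⟨hq, Or.inr (by simpa using h2)⟩ (by simp)
        · simp only [IsTop] at h2
          by_cases ht' : x + y + 1 + z ≤ a + b + c - 2 - N
          · exact Z x (y + 1) z
              ⟨hn _ _ _ rfl, Or.inr (Or.inr (by simp only [IsTop]; omega))⟩ (by simp)
          · exact Y x (y + 1) (z - 1) ⟨hq, Or.inl (by simp only [IsBase]; omega)⟩ (by simp)
    · by_cases hq : (x - 1, y, z) ∈ Λ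
      · exact X x y z ⟨h1.1, Or.inr hq⟩ (by simp)
      · obtain h2 | h2 | h2 := h1.2
        · exact X x y z ⟨h1.1, Or.inl h2⟩ (by simp)
        · have h3 := hcube h2
          by_cases ht' : a + b + c - 2 - N = x + y + (z - 1)
          · by_cases hz : z + 1 ≤ c
            · exact Z (x - 1) y z ⟨hq, Or.inl (by simp only [IsBase]; omega)⟩ (by simp)
            · by_cases hx : a - N ≤ x - 1
              · exact Z (x - 1) y z
                  ⟨hq, Or.inr (Or.inr (by simp only [IsTop]; omega))⟩ (by simp)
              · exact Or.inr ⟨x, y + 1, z, Or.inr (Or.inr ⟨by simp, by omega⟩)⟩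
          · exact Z (x - 1) y z ⟨hq, Or.inr (Or.inl (h.lower _ _ _ (mem_cubes.2 (by omega))
              (Or.inl (by simpa using h2))))⟩ (by simp)
        · simp only [IsTop] at h2
          by_cases hx : a - N ≤ x - 1
          · exact Z (x - 1) y z
              ⟨hq, Or.inr (Or.inr (by simp only [IsTop]; omega))⟩ (by simp)
          · exact Or.inr ⟨x, y + 1, z, Or.inr (Or.inr ⟨by simp, by omega⟩)⟩

lemma IsFace.exists_rightEdge {L : Lozenge} (hL : IsFace L) {k : ℤ}
    (hk : k = level a b c N L.left ∨ k + 1 = level a b c N L.left) :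
    ∃ e ∈ rightEdges L, level a b c N e.1 = k := by
  obtain hk | hk := hk
  · refine ⟨(L.right, L.top), by simp [rightEdges], ?_⟩
    obtain ⟨x, y, z, rfl | rfl | rfl⟩ := hL <;>
      simp only [faceX_mk, faceY_mk, faceZ_mk, level] at hk ⊢ <;> omega
  · refine ⟨(L.bottom, L.right), by simp [rightEdges], ?_⟩
    obtain ⟨x, y, z, rfl | rfl | rfl⟩ := hL <;>
      simp only [faceX_mk, faceY_mk, faceZ_mk, level] at hk ⊢ <;> omega

lemma IsFace.level_leftEdge {L : Lozenge} (hL : IsFace L) {e : Pt × Pt} (he : e ∈ leftEdges L) :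
    level a b c N e.1 = level a b c N L.left ∨ level a b c N e.1 + 1 = level a b c N L.left := by
  obtain ⟨x, y, z, rfl | rfl | rfl⟩ := hL <;>
    simp only [mem_leftEdges_faceX, mem_leftEdges_faceY, mem_leftEdges_faceZ] at he <;>
    obtain rfl | rfl := he <;> simp only [faceX_mk, faceY_mk, faceZ_mk, level, true_or] <;> omega

lemma IsFace.leftEdge_eq {L : Lozenge} (hL : IsFace L) {e e' : Pt × Pt} (he : e ∈ leftEdges L)
    (he' : e' ∈ leftEdges L) (hl : level a b c N e.1 = level a b c N e'.1) : e = e' := by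
  obtain ⟨x, y, z, rfl | rfl | rfl⟩ := hL <;>
    simp only [mem_leftEdges_faceX, mem_leftEdges_faceY, mem_leftEdges_faceZ] at he he' <;>
    obtain rfl | rfl := he <;> obtain rfl | rfl := he' <;> simp only [level] at hl <;>
    first | rfl | omega

/-- The relation "immediately to the left of" inside a set of lozenges. -/
def LeftOfIn (F : Set Lozenge) (L L' : Lozenge) : Prop := L ∈ F ∧ L' ∈ F ∧ LeftOf L L'

/-- Two lozenges of a surface that touch a common strip between two consecutive levels are
comparable: going to the right inside the strip, both reach the unique edge of the strip on the
East border, and going back to the left from there one passes through both. -/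
lemma leftOfIn_total (h : IsLowerPile a b c N Λ) (k : ℤ) {L L' : Lozenge}
    (hL : L ∈ surfaceOf a b c N Λ) (hL' : L' ∈ surfaceOf a b c N Λ)
    (hk : k = level a b c N L.left ∨ k + 1 = level a b c N L.left)
    (hk' : k = level a b c N L'.left ∨ k + 1 = level a b c N L'.left) :
    Relation.ReflTransGen (LeftOfIn (surfaceOf a b c N Λ)) L L' ∨
      Relation.ReflTransGen (LeftOfIn (surfaceOf a b c N Λ)) L' L := by
  set S := surfaceOf a b c N Λ with hS
  let R : Lozenge → Lozenge → Prop := fun L₁ L₂ => L₁ ∈ S ∧ L₂ ∈ S ∧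
    ∃ e ∈ rightEdges L₁, e ∈ leftEdges L₂ ∧ level a b c N e.1 = k
  have hR : ∀ {L₁ L₂}, R L₁ L₂ → LeftOfIn S L₁ L₂ :=
    fun ⟨h1, h2, e, h3, h4, _⟩ => ⟨h1, h2, e, h3, h4⟩
  have hface : ∀ {L}, L ∈ S → IsFace L := fun hL => isFace_of_mem_surfaceOf hL
  have reach : ∀ L ∈ S, (k = level a b c N L.left ∨ k + 1 = level a b c N L.left) →
      ∃ T ∈ S, (∃ e ∈ rightEdges T, level a b c N e.1 = k ∧ EastEdge a b c N e) ∧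
        Relation.ReflTransGen R L T := by
    have : IsStrictOrder Lozenge (fun L₁ L₂ => key L₂ < key L₁) :=
      { irrefl := fun _ => lt_irrefl _, trans := fun _ _ _ h1 h2 => lt_trans h2 h1 }
    have wf : S.WellFoundedOn (fun L₁ L₂ => key L₂ < key L₁) :=
      (finite_surfaceOf h).wellFoundedOn
    intro L hL
    refine wf.induction hL (P := fun L => (k = level a b c N L.left ∨
      k + 1 = level a b c N L.left) → ∃ T ∈ S, (∃ e ∈ rightEdges T, level a b c N e.1 = k ∧
        EastEdge a b c N e) ∧ Relation.ReflTransGen R L T) ?_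
    intro L hL ih hk
    obtain ⟨e, he, hek⟩ := (hface hL).exists_rightEdge hk
    obtain ⟨L₂, hL₂, he₂⟩ | hE := exists_right_neighbour h hL he
    · have hR₂ : R L L₂ := ⟨hL, hL₂, e, he, he₂, hek⟩
      obtain ⟨T, hT, hTe, hTr⟩ := ih L₂ hL₂
        ((hR hR₂).2.2.key_lt (hface hL) (hface hL₂))
        (by have := (hface hL₂).level_leftEdge (a := a) (b := b) (c := c) (N := N) he₂
            rwa [hek] at this)
      exact ⟨T, hT, hTe, hTr.head hR₂⟩
    · exact ⟨L, hL, ⟨e, he, hek, hE⟩, Relation.ReflTransGen.refl⟩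
  obtain ⟨T, hT, ⟨e, he, hek, hE⟩, hLT⟩ := reach L hL hk
  obtain ⟨T', hT', ⟨e', he', hek', hE'⟩, hLT'⟩ := reach L' hL' hk'
  obtain rfl : e = e' := hE.eq_of_level_eq hE' (hek.trans hek'.symm)
  obtain rfl : T = T' := right_unique h hT hT' he he'
  have hu : Relator.RightUnique (Function.swap R) := by
    rintro L₀ L₁ L₂ ⟨h1, h0, e₁, h1', h0', h1k⟩ ⟨h2, -, e₂, h2', h0'', h2k⟩
    obtain rfl : e₁ = e₂ := (hface h0).leftEdge_eq h0' h0'' (h1k.trans h2k.symm)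
    exact right_unique h h1 h2 h1' h2'
  have hmono : ∀ {L₁ L₂}, Relation.ReflTransGen (Function.swap R) L₁ L₂ →
      Relation.ReflTransGen (LeftOfIn S) L₂ L₁ :=
    fun h => Relation.ReflTransGen.mono (fun _ _ => hR) _ _ (Relation.reflTransGen_swap.1 h)
  obtain h1 | h1 := Relation.ReflTransGen.total_of_right_unique hu
    (Relation.reflTransGen_swap.2 hLT) (Relation.reflTransGen_swap.2 hLT')
  exacts [Or.inr (hmono h1), Or.inl (hmono h1)]

end

/-! ### The matrices as operations on sequences of rows -/

section
variable {A : Type*} [CommRing A] {E : Type*} [AddCommGroup E] [Module A E]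

/-- The action of the matrix `V_i`, with first row `d, u` in its block, on a column of vectors
indexed by all the integers. It changes the entry of index `i` only. -/
def rowStep (i : ℤ) (d u : A) (f : ℤ → E) : ℤ → E :=
  Function.update f i (d • f i + u • f (i + 1))

lemma rowStep_comm {i j : ℤ} (h : i + 1 < j ∨ j + 1 < i) (d u d' u' : A) (f : ℤ → E) :
    rowStep i d u (rowStep j d' u' f) = rowStep j d' u' (rowStep i d u f) := by
  have h1 : i ≠ j := by omega
  have h2 : i + 1 ≠ j := by omega
  have h3 : j + 1 ≠ i := by omega
  simp only [rowStep, ne_eq, h1, h1.symm, h2, h3, not_false_eq_true, Function.update_of_ne]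
  exact Function.update_comm h1.symm _ _ _

/-- The action of the matrix of a lozenge. -/
def lozengeStep (a b c : ℤ) (N : ℕ) (τ : Pt → Aˣ) (L : Lozenge) (f : ℤ → E) : ℤ → E :=
  rowStep (level a b c N L.left) ((τ L.left / τ L.right : Aˣ) : A)
    ((τ L.bottom / τ L.right : Aˣ) : A) f

/-- The action of the product of the matrices of a list of lozenges. -/
def act (a b c : ℤ) (N : ℕ) (τ : Pt → Aˣ) (l : List Lozenge) (f : ℤ → E) : ℤ → E :=
  l.foldr (lozengeStep a b c N τ) f

variable {a b c : ℤ} {N : ℕ} {τ : Pt → Aˣ}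

@[simp] lemma act_nil (f : ℤ → E) : act a b c N τ [] f = f := rfl
@[simp] lemma act_cons (L : Lozenge) (l : List Lozenge) (f : ℤ → E) :
    act a b c N τ (L :: l) f = lozengeStep a b c N τ L (act a b c N τ l f) := rfl
@[simp] lemma act_append (l l' : List Lozenge) (f : ℤ → E) :
    act a b c N τ (l ++ l') f = act a b c N τ l (act a b c N τ l' f) := by
  simp [act]

lemma act_eq_zero {n : ℤ} {f : ℤ → E} (hf : ∀ j, n < j → f j = 0) (l : List Lozenge) :
    ∀ j, n < j → act a b c N τ l f j = 0 := by
  induction l with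
  | nil => exact hf
  | cons L l ih =>
    intro j hj
    rw [act_cons, lozengeStep, rowStep]
    by_cases h : j = level a b c N L.left
    · subst h
      rw [Function.update_self, ih _ hj, ih _ (by omega), smul_zero, smul_zero, add_zero]
    · rw [Function.update_of_ne h, ih _ hj]

lemma embed_V_apply (n : ℕ) (i : ℤ) (u v w : Aˣ) (r k : Fin n) :
    embed n i (V u v w) r k =
      (if k = r then (if (r : ℤ) + 1 = i then ((v / w : Aˣ) : A) else 1) else 0) +
      (if (k : ℤ) = r + 1 then (if (r : ℤ) + 1 = i then ((u / w : Aˣ) : A) else 0) else 0) := by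
  simp only [embed, V, Matrix.of_apply, Matrix.cons_val', Matrix.cons_val_zero, Matrix.cons_val_one,
    Matrix.cons_val_fin_one, Fin.ext_iff]
  split_ifs <;> first | omega | simp

lemma sum_embed_V_smul (n : ℕ) (i : ℤ) (u v w : Aˣ) {f : ℤ → E} (hf : ∀ j, (n : ℤ) < j → f j = 0)
    (r : Fin n) :
    ∑ k : Fin n, embed n i (V u v w) r k • f (k + 1) =
      rowStep i ((v / w : Aˣ) : A) ((u / w : Aˣ) : A) f (r + 1) := by
  have h2 : ∑ k : Fin n, (if (k : ℤ) = r + 1 then (if (r : ℤ) + 1 = i then ((u / w : Aˣ) : A)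
      else 0) else 0) • f (k + 1) =
      (if (r : ℤ) + 1 = i then ((u / w : Aˣ) : A) else 0) • f (r + 1 + 1) := by
    by_cases hr : (r : ℕ) + 1 < n
    · rw [Finset.sum_eq_single (⟨r + 1, hr⟩ : Fin n)]
      · simp
      · intro k _ hk
        rw [if_neg, zero_smul]
        intro h
        exact hk (Fin.ext (by simp only; omega))
      · simp
    · rw [hf ((r : ℤ) + 1 + 1) (by omega), smul_zero]
      refine Finset.sum_eq_zero fun k _ => ?_
      rw [if_neg (by omega), zero_smul]
  simp only [embed_V_apply, add_smul, Finset.sum_add_distrib, h2]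
  simp only [ite_smul, zero_smul, Finset.sum_ite_eq', Finset.mem_univ, if_true, rowStep, one_smul]
  by_cases h : (r : ℤ) + 1 = i
  · subst h
    simp
  · simp [h]

lemma sum_readingMatrix_smul {f : ℤ → E} (hf : ∀ j, ((3 * N : ℕ) : ℤ) < j → f j = 0)
    (l : List Lozenge) (r : Fin (3 * N)) :
    ∑ k, readingMatrix a b c N τ l r k • f (k + 1) = act a b c N τ l f (r + 1) := by
  induction l generalizing r with
  | nil => simp [readingMatrix, Matrix.one_apply, ite_smul]
  | cons L l ih =>
    have h := sum_embed_V_smul (3 * N) (level a b c N L.left) (τ L.bottom) (τ L.left) (τ L.right)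
      (act_eq_zero (a := a) (b := b) (c := c) (N := N) (τ := τ) hf l) r
    rw [act_cons, lozengeStep, ← h]
    simp only [← ih, Finset.smul_sum, smul_smul]
    rw [Finset.sum_comm]
    refine Finset.sum_congr rfl fun k _ => ?_
    rw [← Finset.sum_smul]
    rfl

/-- The columns `2N + 1, …, 3N` of the identity matrix, as a sequence of rows. -/
def unitRows (A : Type*) [CommRing A] (N : ℕ) (j : ℤ) : Fin N → A :=
  fun s => if j = 2 * N + s + 1 then 1 else 0

/-- The determinant of the rows `N + 1, …, 2N`. -/
def windowDet (N : ℕ) (f : ℤ → Fin N → A) : A :=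
  (Matrix.of fun r : Fin N => f (N + r + 1)).det

lemma cornerMinor_readingMatrix (l : List Lozenge) :
    cornerMinor N (readingMatrix a b c N τ l) =
      windowDet N (act a b c N τ l (unitRows A N)) := by
  have hf : ∀ j, ((3 * N : ℕ) : ℤ) < j → unitRows A N j = 0 := by
    intro j hj
    funext s
    simp only [unitRows, Pi.zero_apply, ite_eq_right_iff]
    intro h; omega
  unfold cornerMinor windowDet
  congr 1
  ext r s
  have h := congrFun (sum_readingMatrix_smul (a := a) (b := b) (c := c) (τ := τ) hf l
    (⟨N + r, by omega⟩ : Fin (3 * N))) s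
  simp only [Nat.cast_add] at h
  simp only [Matrix.submatrix_apply, Matrix.of_apply]
  rw [← h, Finset.sum_apply, Finset.sum_eq_single (⟨2 * N + s, by omega⟩ : Fin (3 * N))]
  · simp [unitRows]
  · intro k _ hk
    have : ¬ ((k : ℤ) + 1 = 2 * N + s + 1) := fun h' => hk (Fin.ext (by simp only; omega))
    simp [unitRows, this]
  · simp

/-- Addition of a cube does not change the product of the matrices: this is where the cube relation
enters. -/
lemma rowStep_cube (i : ℤ) (t0 t1 t2 t12 t13 t23 t123 : Aˣ)
    (h : (t0 : A) * t123 = t1 * t23 + t2 * t13) (f : ℤ → E) :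
    rowStep (i + 1) ((t13 / t0 : Aˣ) : A) ((t1 / t0 : Aˣ) : A)
      (rowStep i ((t1 / t2 : Aˣ) : A) ((t12 / t2 : Aˣ) : A)
        (rowStep (i + 1) ((t0 / t23 : Aˣ) : A) ((t2 / t23 : Aˣ) : A) f)) =
    rowStep i ((t1 / t123 : Aˣ) : A) ((t12 / t123 : Aˣ) : A)
      (rowStep (i + 1) ((t13 / t23 : Aˣ) : A) ((t123 / t23 : Aˣ) : A)
        (rowStep i ((t123 / t2 : Aˣ) : A) ((t12 / t2 : Aˣ) : A) f)) := by
  have hd : ∀ x y : Aˣ, ((x / y : Aˣ) : A) = x * (y⁻¹ : Aˣ) := fun x y => by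
    rw [div_eq_mul_inv, Units.val_mul]
  have e1 : ((t13 / t0 : Aˣ) : A) * ((t2 / t23 : Aˣ) : A) + ((t1 / t0 : Aˣ) : A) =
      ((t123 / t23 : Aˣ) : A) := by
    simp only [hd]
    linear_combination (-(t0⁻¹ : Aˣ) * (t23⁻¹ : Aˣ) : A) * h -
      (t1 * (t0⁻¹ : Aˣ) : A) * t23.mul_inv + (t123 * (t23⁻¹ : Aˣ) : A) * t0.mul_inv
  have e2 : ((t12 / t2 : Aˣ) : A) * ((t0 / t23 : Aˣ) : A) =
      ((t1 / t123 : Aˣ) : A) * ((t12 / t2 : Aˣ) : A) +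
        ((t12 / t123 : Aˣ) : A) * ((t13 / t23 : Aˣ) : A) := by
    simp only [hd]
    linear_combination (t12 * (t123⁻¹ : Aˣ) * (t2⁻¹ : Aˣ) * (t23⁻¹ : Aˣ) : A) * h -
      (t12 * (t2⁻¹ : Aˣ) * (t23⁻¹ : Aˣ) * t0 : A) * t123.mul_inv +
      (t12 * (t123⁻¹ : Aˣ) * (t2⁻¹ : Aˣ) * t1 : A) * t23.mul_inv +
      (t12 * (t123⁻¹ : Aˣ) * (t23⁻¹ : Aˣ) * t13 : A) * t2.mul_inv
  have e3 : ((t12 / t2 : Aˣ) : A) * ((t2 / t23 : Aˣ) : A) =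
      ((t12 / t123 : Aˣ) : A) * ((t123 / t23 : Aˣ) : A) := by
    rw [← Units.val_mul, ← Units.val_mul]; simp
  have e4 : ((t13 / t0 : Aˣ) : A) * ((t0 / t23 : Aˣ) : A) = ((t13 / t23 : Aˣ) : A) := by
    rw [← Units.val_mul]; simp
  have e5 : ((t1 / t2 : Aˣ) : A) = ((t1 / t123 : Aˣ) : A) * ((t123 / t2 : Aˣ) : A) := by
    rw [← Units.val_mul]; simp
  funext j
  by_cases h1 : j = i
  · subst h1
    have n1 : j + 1 ≠ j := by omega
    have n2 : j ≠ j + 1 := by omega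
    have n3 : j + 1 + 1 ≠ j := by omega
    simp only [rowStep, Function.update_self, ne_eq, n1, n2, n3, not_false_eq_true,
      Function.update_of_ne, smul_add, smul_smul]
    rw [e2, e3, e5, add_smul]
    abel
  · by_cases h2 : j = i + 1
    · subst h2
      have n1 : i + 1 + 1 ≠ i + 1 := by omega
      have n2 : i + 1 + 1 ≠ i := by omega
      have n3 : i + 1 ≠ i := by omega
      simp only [rowStep, Function.update_self, ne_eq, n1, n2, n3, not_false_eq_true,
        Function.update_of_ne, smul_add, smul_smul]
      rw [← e1, e4, add_smul]
      abel
    · simp [rowStep, h1, h2]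

end

/-! ### Independence of the reading and addition of a cube -/

/-- Two lists with the same members act in the same way if each pair of members commutes or
comes in a prescribed order in both lists. -/
lemma foldr_eq_of_perm {α β : Type*} (op : α → β → β) (R : α → α → Prop) (l l' : List α)
    (hp : l.Perm l') (hl : l.Pairwise fun x y => ¬ R y x) (hl' : l'.Pairwise fun x y => ¬ R y x)
    (hR : ∀ x ∈ l, ∀ y ∈ l, (∀ f, op x (op y f) = op y (op x f)) ∨ R x y ∨ R y x) (f : β) :
    l.foldr op f = l'.foldr op f := by
  induction l generalizing l' with
  | nil => rw [hp.nil_eq]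
  | cons x t ih =>
    obtain ⟨s, u, rfl⟩ := List.append_of_mem (hp.subset (List.mem_cons_self (a := x) (l := t)))
    have hp' : t.Perm (s ++ u) := (List.perm_cons x).1 (hp.trans List.perm_middle)
    have hs : ∀ y ∈ s, ∀ g, op x (op y g) = op y (op x g) := by
      intro y hy
      have hyt : y ∈ t := hp'.symm.subset (List.mem_append_left _ hy)
      obtain h | h | h := hR x List.mem_cons_self y (List.mem_cons_of_mem _ hyt)
      · exact h
      · exact absurd h ((List.pairwise_append.1 hl').2.2 y hy x List.mem_cons_self)
      · exact absurd h ((List.pairwise_cons.1 hl).1 y hyt)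
    have hmove : ∀ (s : List α), (∀ y ∈ s, ∀ g, op x (op y g) = op y (op x g)) → ∀ g,
        s.foldr op (op x g) = op x (s.foldr op g) := by
      intro s
      induction s with
      | nil => intro _ g; rfl
      | cons y s ihs =>
        intro h g
        rw [List.foldr_cons, ihs (fun z hz => h z (List.mem_cons_of_mem _ hz)), List.foldr_cons,
          h y List.mem_cons_self]
    rw [List.foldr_append, List.foldr_cons, List.foldr_cons, hmove s hs, ← List.foldr_append]
    congr 1
    refine ih _ hp' (List.pairwise_cons.1 hl).2 ?_ fun y hy z hz =>
      hR y (List.mem_cons_of_mem _ hy) z (List.mem_cons_of_mem _ hz)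
    exact hl'.sublist (List.Sublist.append_left (List.sublist_cons_self x u) s)

/-- The order of a reading is compatible with chains of lozenges. -/
lemma IsReading.pairwise_chain {F : Set Lozenge} {l : List Lozenge} (hl : IsReading F l) :
    l.Pairwise fun L L' => ¬ Relation.ReflTransGen (LeftOfIn F) L' L := by
  classical
  obtain ⟨hnd, hm, hp⟩ := hl
  have h1 : ∀ L L', LeftOfIn F L L' → l.idxOf L ≤ l.idxOf L' := by
    rintro L L' ⟨hL, hL', h⟩
    by_contra! hlt
    have h2 := List.pairwise_iff_getElem.1 hp _ _ (List.idxOf_lt_length_of_mem ((hm _).2 hL'))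
      (List.idxOf_lt_length_of_mem ((hm _).2 hL)) hlt
    simp only [List.getElem_idxOf] at h2
    exact h2 h
  have h2 : ∀ L L', Relation.ReflTransGen (LeftOfIn F) L L' → l.idxOf L ≤ l.idxOf L' := by
    intro L L' h
    induction h with
    | refl => exact le_rfl
    | tail _ h' ih => exact ih.trans (h1 _ _ h')
  rw [List.pairwise_iff_getElem]
  intro i j hi hj hij h
  have := h2 _ _ h
  rw [hnd.idxOf_getElem, hnd.idxOf_getElem] at this
  omega

section
variable {A : Type*} [CommRing A] {E : Type*} [AddCommGroup E] [Module A E]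
variable {a b c : ℤ} {N : ℕ} {τ : Pt → Aˣ} {Λ : Set Pt}

/-- Two lozenges of a surface act by commuting operations or are comparable. -/
lemma commute_or_chain (h : IsLowerPile a b c N Λ) {L L' : Lozenge}
    (hL : L ∈ surfaceOf a b c N Λ) (hL' : L' ∈ surfaceOf a b c N Λ) :
    (∀ f : ℤ → E, lozengeStep a b c N τ L (lozengeStep a b c N τ L' f) =
      lozengeStep a b c N τ L' (lozengeStep a b c N τ L f)) ∨
    Relation.ReflTransGen (LeftOfIn (surfaceOf a b c N Λ)) L L' ∨
      Relation.ReflTransGen (LeftOfIn (surfaceOf a b c N Λ)) L' L := by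
  by_cases h1 : level a b c N L.left + 1 < level a b c N L'.left ∨
      level a b c N L'.left + 1 < level a b c N L.left
  · exact Or.inl fun f => rowStep_comm h1 _ _ _ _ f
  · refine Or.inr (leftOfIn_total h (min (level a b c N L.left) (level a b c N L'.left)) hL hL' ?_ ?_)
      <;> omega

lemma act_eq_of_isReading (h : IsLowerPile a b c N Λ) {l l' : List Lozenge}
    (hl : IsReading (surfaceOf a b c N Λ) l) (hl' : IsReading (surfaceOf a b c N Λ) l')
    (f : ℤ → E) : act a b c N τ l f = act a b c N τ l' f :=
  foldr_eq_of_perm _ _ l l'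
    ((List.perm_ext_iff_of_nodup hl.1 hl'.1).2 fun L => by rw [hl.2.1, hl'.2.1])
    hl.pairwise_chain hl'.pairwise_chain
    (fun L hL L' hL' => commute_or_chain h ((hl.2.1 L).1 hL) ((hl.2.1 L').1 hL')) f

lemma exists_isReading_surfaceOf (h : IsLowerPile a b c N Λ) :
    ∃ l, IsReading (surfaceOf a b c N Λ) l :=
  exists_isReading (finite_surfaceOf h) fun _ => isFace_of_mem_surfaceOf

lemma act_lozengeStep_comm (L : Lozenge) (s : List Lozenge)
    (hs : ∀ w ∈ s, ∀ f : ℤ → E, lozengeStep a b c N τ L (lozengeStep a b c N τ w f) =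
      lozengeStep a b c N τ w (lozengeStep a b c N τ L f)) (f : ℤ → E) :
    act a b c N τ s (lozengeStep a b c N τ L f) = lozengeStep a b c N τ L (act a b c N τ s f) := by
  induction s with
  | nil => rfl
  | cons w s ih =>
    rw [act_cons, ih fun w' hw' => hs w' (List.mem_cons_of_mem _ hw'), act_cons,
      hs w List.mem_cons_self]

lemma leftOf_bottom (x y z : ℤ) :
    LeftOf (faceY (x, y, z)) (faceZ (x, y, z)) ∧ LeftOf (faceZ (x, y, z)) (faceX (x, y, z)) :=
  ⟨⟨((x + 1, y, z), (x, y, z)), mem_rightEdges_faceY.2 (by simp), mem_leftEdges_faceZ.2 (by simp)⟩,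
    ⟨((x, y + 1, z), (x, y, z)), mem_rightEdges_faceZ.2 (by simp), mem_leftEdges_faceX.2 (by simp)⟩⟩

lemma lozengeStep_cube {x y z : ℤ} (hτ : CubeRelation τ (x, y, z)) (f : ℤ → E) :
    lozengeStep a b c N τ (faceY (x, y, z)) (lozengeStep a b c N τ (faceZ (x, y, z))
      (lozengeStep a b c N τ (faceX (x, y, z)) f)) =
    lozengeStep a b c N τ (faceX (x + 1, y, z)) (lozengeStep a b c N τ (faceZ (x, y, z + 1))
      (lozengeStep a b c N τ (faceY (x, y + 1, z)) f)) := by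
  simp only [CubeRelation, add_e1, add_e2, add_e3] at hτ
  have h := rowStep_cube (E := E) (level a b c N (x + 1, y, z)) (τ (x, y, z)) (τ (x + 1, y, z))
    (τ (x, y + 1, z)) (τ (x + 1, y + 1, z)) (τ (x + 1, y, z + 1)) (τ (x, y + 1, z + 1))
    (τ (x + 1, y + 1, z + 1)) hτ f
  have l1 : level a b c N (x, y, z) = level a b c N (x + 1, y, z) + 1 := by
    simp only [level]; ring
  have l2 : level a b c N (x + 1, y, z + 1) = level a b c N (x + 1, y, z) + 1 := by
    simp only [level]; ring
  have l3 : level a b c N (x + 1, y + 1, z + 1) = level a b c N (x + 1, y, z) := by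
    simp only [level]; ring
  simp only [lozengeStep, faceX_mk, faceY_mk, faceZ_mk, l1, l2, l3]
  exact h

/-- The left edges of the three top faces of a cube are those of its bottom faces, apart from edges
that are right edges of top faces. -/
lemma leftEdges_topFaces {x y z : ℤ} {t : Lozenge} (ht : t ∈ topFaces (x, y, z)) {e : Pt × Pt}
    (he : e ∈ leftEdges t) : ∃ t', e ∈ rightEdges t' ∧ t' ∈ topFaces (x, y, z) ∨
      e ∈ leftEdges t' ∧ (t' = faceY (x, y, z) ∨ t' = faceZ (x, y, z)) := by
  obtain rfl | rfl | rfl := mem_topFaces.1 ht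
  · obtain rfl | rfl := mem_leftEdges_faceX.1 he
    · exact ⟨_, Or.inr ⟨mem_leftEdges_faceZ.2 (Or.inl rfl), Or.inr rfl⟩⟩
    · exact ⟨_, Or.inr ⟨mem_leftEdges_faceY.2 (Or.inl rfl), Or.inl rfl⟩⟩
  · obtain rfl | rfl := mem_leftEdges_faceY.1 he
    · exact ⟨_, Or.inl ⟨mem_rightEdges_faceX.2 (Or.inl rfl), mem_topFaces.2 (Or.inl rfl)⟩⟩
    · exact ⟨_, Or.inl ⟨mem_rightEdges_faceZ.2 (Or.inl rfl), mem_topFaces.2 (Or.inr (Or.inr rfl))⟩⟩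
  · obtain rfl | rfl := mem_leftEdges_faceZ.1 he
    · exact ⟨_, Or.inl ⟨mem_rightEdges_faceX.2 (Or.inr rfl), mem_topFaces.2 (Or.inl rfl)⟩⟩
    · exact ⟨_, Or.inr ⟨mem_leftEdges_faceY.2 (Or.inr rfl), Or.inl rfl⟩⟩

/-- The right edges of the three top faces of a cube are those of its bottom faces, apart from edges
that are left edges of top faces. -/
lemma rightEdges_topFaces {x y z : ℤ} {t : Lozenge} (ht : t ∈ topFaces (x, y, z)) {e : Pt × Pt}
    (he : e ∈ rightEdges t) : ∃ t', e ∈ leftEdges t' ∧ t' ∈ topFaces (x, y, z) ∨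
      e ∈ rightEdges t' ∧ (t' = faceX (x, y, z) ∨ t' = faceZ (x, y, z)) := by
  obtain rfl | rfl | rfl := mem_topFaces.1 ht
  · obtain rfl | rfl := mem_rightEdges_faceX.1 he
    · exact ⟨_, Or.inl ⟨mem_leftEdges_faceY.2 (Or.inl rfl), mem_topFaces.2 (Or.inr (Or.inl rfl))⟩⟩
    · exact ⟨_, Or.inl ⟨mem_leftEdges_faceZ.2 (Or.inl rfl), mem_topFaces.2 (Or.inr (Or.inr rfl))⟩⟩
  · obtain rfl | rfl := mem_rightEdges_faceY.1 he
    · exact ⟨_, Or.inr ⟨mem_rightEdges_faceZ.2 (Or.inl rfl), Or.inr rfl⟩⟩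
    · exact ⟨_, Or.inr ⟨mem_rightEdges_faceX.2 (Or.inl rfl), Or.inl rfl⟩⟩
  · obtain rfl | rfl := mem_rightEdges_faceZ.1 he
    · exact ⟨_, Or.inl ⟨mem_leftEdges_faceY.2 (Or.inr rfl), mem_topFaces.2 (Or.inr (Or.inl rfl))⟩⟩
    · exact ⟨_, Or.inr ⟨mem_rightEdges_faceX.2 (Or.inr rfl), Or.inl rfl⟩⟩

/-- The lozenges created by the addition of a cube are new. -/
lemma topFaces_disjoint {x y z : ℤ} (hQ : (x, y, z) ∈ cubes a b c N)
    (hn : (x, y, z) ∉ Λ) {t : Lozenge} (ht : t ∈ topFaces (x, y, z)) :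
    t ∉ surfaceOf a b c N Λ := by
  have hQ' := mem_cubes.1 hQ
  obtain rfl | rfl | rfl := mem_topFaces.1 ht <;> intro hS
  · exact hn (by simpa using (faceX_mem_surfaceOf.1 hS).mem_of_time_le (by omega))
  · exact hn (by simpa using (faceY_mem_surfaceOf.1 hS).mem_of_time_le (by omega))
  · exact hn (by simpa using (faceZ_mem_surfaceOf.1 hS).mem_of_time_le (by omega))

/-- The three bottom faces of a cube occur in every reading in the order `Y`, `Z`, `X`. -/
lemma IsReading.exists_split {S : Set Lozenge} {l : List Lozenge} (hl : IsReading S l) {x y z : ℤ}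
    (hb : bottomFaces (x, y, z) ⊆ S) : ∃ l₁ l₂ l₃ l₄, l = l₁ ++ faceY (x, y, z) ::
      (l₂ ++ faceZ (x, y, z) :: (l₃ ++ faceX (x, y, z) :: l₄)) := by
  obtain ⟨-, hm, hp⟩ := hl
  obtain ⟨hYZ, hZX⟩ := leftOf_bottom x y z
  obtain ⟨l₁, t, rfl⟩ :=
    List.append_of_mem ((hm (faceY (x, y, z))).2 (hb (mem_bottomFaces.2 (Or.inr (Or.inl rfl)))))
  have hZt : faceZ (x, y, z) ∈ t := by
    have := (hm (faceZ (x, y, z))).2 (hb (mem_bottomFaces.2 (Or.inr (Or.inr rfl))))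
    simp only [List.mem_append, List.mem_cons] at this
    obtain h1 | h1 | h1 := this
    · exact absurd hYZ ((List.pairwise_append.1 hp).2.2 _ h1 _ List.mem_cons_self)
    · exact absurd h1.symm (faceY_ne_faceZ _ _)
    · exact h1
  obtain ⟨l₂, t, rfl⟩ := List.append_of_mem hZt
  have hp2 := (List.pairwise_cons.1 (List.pairwise_append.1 hp).2.1)
  have hXt : faceX (x, y, z) ∈ t := by
    have := (hm (faceX (x, y, z))).2 (hb (mem_bottomFaces.2 (Or.inl rfl)))
    simp only [List.mem_append, List.mem_cons] at this
    obtain h1 | h1 | h1 | h1 | h1 := this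
    · exact absurd hZX ((List.pairwise_append.1 hp).2.2 _ h1 _ (by simp))
    · exact absurd h1 (faceX_ne_faceY _ _)
    · exact absurd hZX ((List.pairwise_append.1 hp2.2).2.2 _ h1 _ (by simp))
    · exact absurd h1 (faceX_ne_faceZ _ _)
    · exact h1
  obtain ⟨l₃, l₄, rfl⟩ := List.append_of_mem hXt
  exact ⟨l₁, l₂, l₃, l₄, rfl⟩

/-- Replacing the bottom faces of a cube in a reading by the top faces, inserted between `Y` and `X`
with the lozenges from `Y` to `Z` moved before them and those from `Z` to `X` behind them, gives a
reading of the surface with the cube added. -/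
lemma IsReading.insert_cube (h : IsLowerPile a b c N Λ) {x y z : ℤ}
    (hb : bottomFaces (x, y, z) ⊆ surfaceOf a b c N Λ) {l₁ l₂ l₃ l₄ : List Lozenge}
    (hl : IsReading (surfaceOf a b c N Λ) (l₁ ++ faceY (x, y, z) ::
      (l₂ ++ faceZ (x, y, z) :: (l₃ ++ faceX (x, y, z) :: l₄)))) :
    IsReading (surfaceOf a b c N (insert (x, y, z) Λ)) ((l₁ ++ l₂) ++
      ([faceX (x + 1, y, z), faceZ (x, y, z + 1), faceY (x, y + 1, z)] ++ (l₃ ++ l₄))) := by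
  obtain ⟨hQ, hn, hΛ'⟩ := h.of_bottomFaces_subset hb
  have hS' := surfaceOf_insert h hQ hn
  set S := surfaceOf a b c N Λ with hS
  obtain ⟨hnd, hm, hp⟩ := hl
  set X := faceX (x, y, z) with hX
  set Y := faceY (x, y, z) with hY
  set Z := faceZ (x, y, z) with hZ
  have hperm : (l₁ ++ Y :: (l₂ ++ Z :: (l₃ ++ X :: l₄))).Perm
      (X :: Y :: Z :: ((l₁ ++ l₂) ++ (l₃ ++ l₄))) := by
    classical
    rw [List.perm_iff_count]
    intro w
    simp only [List.count_append, List.count_cons]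
    omega
  have hpY : ∀ w ∈ l₃ ++ l₄, ¬ LeftOf w Y ∧ ¬ LeftOf w Z := by
    have e : l₁ ++ Y :: (l₂ ++ Z :: (l₃ ++ X :: l₄)) =
      (l₁ ++ Y :: (l₂ ++ [Z])) ++ (l₃ ++ X :: l₄) := by simp
    rw [e] at hp
    have hp := (List.pairwise_append.1 hp).2.2
    intro w hw
    have hw' : w ∈ l₃ ++ X :: l₄ := by
      rw [List.mem_append] at hw ⊢
      exact hw.imp_right (List.mem_cons_of_mem _)
    exact ⟨hp Y (by simp) w hw', hp Z (by simp) w hw'⟩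
  have hpX : ∀ w ∈ l₁ ++ l₂, ¬ LeftOf X w ∧ ¬ LeftOf Z w := by
    have e : l₁ ++ Y :: (l₂ ++ Z :: (l₃ ++ X :: l₄)) =
      (l₁ ++ Y :: l₂) ++ (Z :: (l₃ ++ X :: l₄)) := by simp
    rw [e] at hp
    have hp := (List.pairwise_append.1 hp).2.2
    intro w hw
    have hw' : w ∈ l₁ ++ Y :: l₂ := by
      rw [List.mem_append] at hw ⊢
      exact hw.imp_right (List.mem_cons_of_mem _)
    exact ⟨hp w hw' X (by simp), hp w hw' Z (by simp)⟩
  have hsub : ((l₁ ++ l₂) ++ (l₃ ++ l₄)).Sublist (l₁ ++ Y :: (l₂ ++ Z :: (l₃ ++ X :: l₄))) := by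
    rw [List.append_assoc]
    refine List.Sublist.append_left (List.Sublist.cons _ ?_) _
    refine List.Sublist.append_left (List.Sublist.cons _ ?_) _
    exact List.Sublist.append_left (List.sublist_cons_self _ _) _
  have hnd' := List.nodup_append'.1 (hnd.sublist hsub)
  have hp' := List.pairwise_append.1 (hp.sublist hsub)
  have hnd3 := hperm.nodup_iff.1 hnd
  have hm3 : ∀ w, w ∈ X :: Y :: Z :: ((l₁ ++ l₂) ++ (l₃ ++ l₄)) ↔ w ∈ S :=
    fun w => hperm.mem_iff.symm.trans (hm w)
  generalize l₁ ++ l₂ = s at hnd' hp' hpX hnd3 hm3 ⊢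
  generalize l₃ ++ l₄ = t at hnd' hp' hpY hnd3 hm3 ⊢
  have htop : ∀ w, w ∈ [faceX (x + 1, y, z), faceZ (x, y, z + 1), faceY (x, y + 1, z)] ↔
      w ∈ topFaces (x, y, z) := by
    intro w
    simp only [List.mem_cons, List.not_mem_nil, or_false, mem_topFaces]
    exact or_congr Iff.rfl or_comm
  have hrest : ∀ w, w ∈ s ++ t ↔ w ∈ S ∧ w ∉ bottomFaces (x, y, z) := by
    intro w
    rw [← hm3 w, mem_bottomFaces, ← hX, ← hY, ← hZ]
    simp only [List.nodup_cons, List.mem_cons] at hnd3 ⊢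
    constructor
    · refine fun hw => ⟨Or.inr (Or.inr (Or.inr hw)), ?_⟩
      rintro (rfl | rfl | rfl)
      exacts [hnd3.1 (Or.inr (Or.inr hw)), hnd3.2.1 (Or.inr hw), hnd3.2.2.1 hw]
    · tauto
  have hdisj : ∀ w ∈ topFaces (x, y, z), w ∉ s ++ t :=
    fun w hw hw' => topFaces_disjoint hQ hn hw ((hrest w).1 hw').1
  have hnew : ∀ w ∈ s ++ t, w ∈ surfaceOf a b c N (insert (x, y, z) Λ) :=
    fun w hw => hS' ▸ Or.inl ((hrest w).1 hw)
  have htnew : ∀ w ∈ topFaces (x, y, z), w ∈ surfaceOf a b c N (insert (x, y, z) Λ) :=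
    fun w hw => hS' ▸ Or.inr hw
  refine ⟨?_, ?_, ?_⟩
  · refine List.nodup_append'.2 ⟨hnd'.1, List.nodup_append'.2 ⟨?_, hnd'.2.1, ?_⟩, ?_⟩
    · simp [faceX_ne_faceY, faceX_ne_faceZ, (faceY_ne_faceZ _ _).symm]
    · exact fun w hw hw' => hdisj w ((htop w).1 hw) (List.mem_append_right _ hw')
    · intro w hw hw'
      obtain hw' | hw' := List.mem_append.1 hw'
      · exact hdisj w ((htop w).1 hw') (List.mem_append_left _ hw)
      · exact hnd'.2.2 hw hw'
  · intro w
    rw [← hS', Set.mem_union, Set.mem_sdiff, ← hrest, ← htop]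
    simp only [List.mem_append, or_assoc]
    exact or_congr Iff.rfl or_comm
  · refine List.pairwise_append.2 ⟨hp'.1, List.pairwise_append.2 ⟨?_, hp'.2.1, ?_⟩, ?_⟩
    · have hk : ∀ {L L'}, L ∈ topFaces (x, y, z) → L' ∈ topFaces (x, y, z) → key L < key L' →
          ¬ LeftOf L' L := fun h1 h2 hlt hlo => lt_asymm hlt
            (hlo.key_lt (isFace_of_mem_topFaces h2) (isFace_of_mem_topFaces h1))
      have k1 : key (faceX (x + 1, y, z)) < key (faceZ (x, y, z + 1)) := by
        simp only [key, faceX_mk, faceZ_mk, Prod.Lex.toLex_lt_toLex]; omega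
      have k2 : key (faceZ (x, y, z + 1)) < key (faceY (x, y + 1, z)) := by
        simp only [key, faceY_mk, faceZ_mk, Prod.Lex.toLex_lt_toLex]; omega
      have m1 : faceX (x + 1, y, z) ∈ topFaces (x, y, z) := mem_topFaces.2 (Or.inl rfl)
      have m2 : faceY (x, y + 1, z) ∈ topFaces (x, y, z) :=
        mem_topFaces.2 (Or.inr (Or.inl rfl))
      have m3 : faceZ (x, y, z + 1) ∈ topFaces (x, y, z) :=
        mem_topFaces.2 (Or.inr (Or.inr rfl))
      simp only [List.pairwise_cons, List.mem_cons, List.not_mem_nil, or_false, forall_eq_or_imp,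
        forall_eq, IsEmpty.forall_iff, implies_true, List.Pairwise.nil, and_true]
      exact ⟨⟨hk m1 m3 k1, hk m1 m2 (k1.trans k2)⟩, hk m3 m2 k2⟩
    · rintro v hv w hw ⟨e, hew, hev⟩
      have hw' := List.mem_append_right s hw
      obtain ⟨v', ⟨h1, h2⟩ | ⟨h1, rfl | rfl⟩⟩ := leftEdges_topFaces ((htop v).1 hv) hev
      · cases right_unique hΛ' (htnew _ h2) (hnew w hw') h1 hew
        exact hdisj _ h2 hw'
      · exact (hpY w hw).1 ⟨e, hew, h1⟩
      · exact (hpY w hw).2 ⟨e, hew, h1⟩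
    · intro w hw v hv
      have hw' := List.mem_append_left t hw
      obtain hv | hv := List.mem_append.1 hv
      · rintro ⟨e, hev, hew⟩
        obtain ⟨v', ⟨h1, h2⟩ | ⟨h1, rfl | rfl⟩⟩ := rightEdges_topFaces ((htop v).1 hv) hev
        · cases left_unique hΛ' (htnew _ h2) (hnew w hw') h1 hew
          exact hdisj _ h2 hw'
        · exact (hpX w hw).1 ⟨e, h1, hew⟩
        · exact (hpX w hw).2 ⟨e, h1, hew⟩
      · exact hp'.2.2 w hw v hv

/-- Given a reading of a surface and a cube that can be added, there is a reading of the surface with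
the cube added that gives the same product. -/
lemma exists_isReading_insert (h : IsLowerPile a b c N Λ) {x y z : ℤ}
    (hb : bottomFaces (x, y, z) ⊆ surfaceOf a b c N Λ) {l : List Lozenge}
    (hl : IsReading (surfaceOf a b c N Λ) l) (hτ : CubeRelation τ (x, y, z)) :
    ∃ l', IsReading (surfaceOf a b c N (insert (x, y, z) Λ)) l' ∧
      ∀ f : ℤ → E, act a b c N τ l f = act a b c N τ l' f := by
  obtain ⟨l₁, l₂, l₃, l₄, rfl⟩ := hl.exists_split hb
  refine ⟨_, hl.insert_cube h hb, ?_⟩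
  have hchain := hl.pairwise_chain
  have hXS := hb (mem_bottomFaces.2 (Or.inl rfl))
  have hYS := hb (mem_bottomFaces.2 (Or.inr (Or.inl rfl)))
  have hZS := hb (mem_bottomFaces.2 (Or.inr (Or.inr rfl)))
  replace hm := hl.2.1
  set S := surfaceOf a b c N Λ with hS
  set X := faceX (x, y, z) with hX
  set Y := faceY (x, y, z) with hY
  set Z := faceZ (x, y, z) with hZ
  have hbefore : ∀ s t, l₁ ++ Y :: (l₂ ++ Z :: (l₃ ++ X :: l₄)) = s ++ t → ∀ u ∈ s, ∀ v ∈ t,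
      ¬ Relation.ReflTransGen (LeftOfIn S) v u := by
    intro s t hst u hu v hv
    rw [hst] at hchain
    exact (List.pairwise_append.1 hchain).2.2 u hu v hv
  -- a lozenge between `Y` and `Z` in the reading commutes with `Y`, as only `Z` and `X` touch `Y`
  -- on its right
  have hY2 : ∀ w ∈ l₂, ∀ f : ℤ → E, lozengeStep a b c N τ Y (lozengeStep a b c N τ w f) =
      lozengeStep a b c N τ w (lozengeStep a b c N τ Y f) := by
    intro w hw
    have hb1 := hbefore (l₁ ++ Y :: l₂) (Z :: (l₃ ++ X :: l₄)) (by simp) w (by simp [hw])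
    obtain h1 | h1 | h1 := commute_or_chain (E := E) (τ := τ) h hYS ((hm w).1 (by simp [hw]))
    · exact h1
    · obtain h2 | ⟨s, ⟨-, hs, e, he, hes⟩, h2⟩ := h1.cases_head
      · intro f; rw [h2]
      · obtain rfl | rfl := mem_rightEdges_faceY.1 he
        · cases left_unique h hs hZS hes (mem_leftEdges_faceZ.2 (Or.inr rfl))
          exact absurd h2 (hb1 Z (by simp))
        · cases left_unique h hs hXS hes (mem_leftEdges_faceX.2 (Or.inr rfl))
          exact absurd h2 (hb1 X (by simp))
    · exact absurd h1 (hbefore (l₁ ++ [Y]) (l₂ ++ Z :: (l₃ ++ X :: l₄)) (by simp) Y (by simp) w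
        (by simp [hw]))
  -- likewise, a lozenge between `Z` and `X` commutes with `X`
  have hX3 : ∀ w ∈ l₃, ∀ f : ℤ → E, lozengeStep a b c N τ X (lozengeStep a b c N τ w f) =
      lozengeStep a b c N τ w (lozengeStep a b c N τ X f) := by
    intro w hw
    have hb1 : ∀ u ∈ l₁ ++ Y :: (l₂ ++ [Z]), ¬ Relation.ReflTransGen (LeftOfIn S) w u :=
      fun u hu => hbefore _ (l₃ ++ X :: l₄) (by simp) u hu w (by simp [hw])
    obtain h1 | h1 | h1 := commute_or_chain (E := E) (τ := τ) h ((hm w).1 (by simp [hw])) hXS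
    · exact fun f => (h1 f).symm
    · obtain h2 | ⟨s, h2, ⟨hs, -, e, hes, he⟩⟩ := h1.cases_tail
      · intro f; rw [h2]
      · obtain rfl | rfl := mem_leftEdges_faceX.1 he
        · cases right_unique h hs hZS hes (mem_rightEdges_faceZ.2 (Or.inr rfl))
          exact absurd h2 (hb1 Z (by simp))
        · cases right_unique h hs hYS hes (mem_rightEdges_faceY.2 (Or.inr rfl))
          exact absurd h2 (hb1 Y (by simp))
    · exact absurd h1 (hbefore (l₁ ++ Y :: (l₂ ++ Z :: l₃)) (X :: l₄) (by simp) w (by simp [hw]) X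
        (by simp))
  intro f
  simp only [act_append, act_cons, act_nil]
  rw [act_lozengeStep_comm X l₃ hX3, ← lozengeStep_cube hτ, ← act_lozengeStep_comm Y l₂ hY2]

/-- The product of the matrices does not change when all the missing cubes are added. -/
lemma act_eq_act_cubes {l l' : List Lozenge} (h : IsLowerPile a b c N Λ)
    (hl : IsReading (surfaceOf a b c N Λ) l)
    (hτ : ∀ p ∈ cubes a b c N, p ∉ Λ → CubeRelation τ p)
    (hl' : IsReading (surfaceOf a b c N (cubes a b c N)) l') (f : ℤ → E) :
    act a b c N τ l f = act a b c N τ l' f := by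
  have hfin : (cubes a b c N \ Λ).Finite := (finite_cubes a b c N).subset Set.sdiff_subset
  induction hk : (cubes a b c N \ Λ).ncard using Nat.strong_induction_on generalizing Λ l with
  | _ k ih =>
    by_cases hne : ∃ p ∈ cubes a b c N, p ∉ Λ
    · obtain ⟨⟨x, y, z⟩, hQ, hn, hb⟩ := exists_addable hne
      obtain ⟨l₂, hl₂, he⟩ := exists_isReading_insert (E := E) h hb hl (hτ _ hQ hn)
      rw [he]
      have hss : cubes a b c N \ insert (x, y, z) Λ ⊂ cubes a b c N \ Λ := by
        refine ⟨Set.sdiff_subset_sdiff_right (Set.subset_insert _ _), fun hsub => ?_⟩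
        exact (hsub ⟨hQ, hn⟩).2 (Set.mem_insert _ _)
      exact ih _ (hk ▸ Set.ncard_lt_ncard hss hfin) (h.of_bottomFaces_subset hb).2.2 hl₂
        (fun p hp hp' => hτ p hp fun h' => hp' (Set.mem_insert_of_mem _ h'))
        (hfin.subset hss.subset) rfl
    · push Not at hne
      obtain rfl : Λ = cubes a b c N := subset_antisymm h.subset hne
      exact act_eq_of_isReading h hl hl' f

end

/-! ### The surface of the cube corner -/

section
variable {a b c : ℤ} {N : ℕ}

/-- The row of the top rhombus at ordinate `y`, reduced to its `K` rightmost lozenges and read from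
left to right. -/
def zString (a c : ℤ) (N : ℕ) (y : ℤ) : ℕ → List Lozenge
  | 0 => []
  | K + 1 => faceZ (a - N + K, y, c) :: zString a c N y K

/-- The last `T` rows of the top rhombus, in the order of a reading. -/
def zRows (a b c : ℤ) (N : ℕ) : ℕ → List Lozenge
  | 0 => []
  | T + 1 => zString a c N (b - 1 - T) N ++ zRows a b c N T

lemma mem_zString {y : ℤ} {K : ℕ} {L : Lozenge} : L ∈ zString a c N y K ↔
    ∃ x, a - N ≤ x ∧ x < a - N + K ∧ L = faceZ (x, y, c) := by
  induction K with
  | zero =>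
    simp only [zString, List.not_mem_nil, false_iff]
    rintro ⟨x, h1, h2, -⟩
    simp at h2
    omega
  | succ K ih =>
    rw [zString, List.mem_cons, ih]
    push_cast
    constructor
    · rintro (rfl | ⟨x, h1, h2, rfl⟩)
      · exact ⟨_, by omega, by omega, rfl⟩
      · exact ⟨x, h1, by omega, rfl⟩
    · rintro ⟨x, h1, h2, rfl⟩
      by_cases hx : x = a - N + K
      · exact Or.inl (by rw [hx])
      · exact Or.inr ⟨x, h1, by omega, rfl⟩

lemma mem_zRows {T : ℕ} {L : Lozenge} : L ∈ zRows a b c N T ↔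
    ∃ x y, a - N ≤ x ∧ x < a ∧ b - T ≤ y ∧ y < b ∧ L = faceZ (x, y, c) := by
  induction T with
  | zero =>
    simp only [zRows, List.not_mem_nil, false_iff]
    rintro ⟨x, y, -, -, h1, h2, -⟩
    simp at h1
    omega
  | succ T ih =>
    rw [zRows, List.mem_append, ih, mem_zString]
    push_cast
    constructor
    · rintro (⟨x, h1, h2, rfl⟩ | ⟨x, y, h1, h2, h3, h4, rfl⟩)
      · exact ⟨x, _, h1, by omega, by omega, by omega, rfl⟩
      · exact ⟨x, y, h1, h2, by omega, h4, rfl⟩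
    · rintro ⟨x, y, h1, h2, h3, h4, rfl⟩
      by_cases hy : y = b - 1 - T
      · exact Or.inl ⟨x, h1, by omega, by rw [hy]⟩
      · exact Or.inr ⟨x, y, h1, h2, by omega, h4, rfl⟩

lemma leftOf_faceZ {x y z x' y' z' : ℤ} (h : LeftOf (faceZ (x, y, z)) (faceZ (x', y', z'))) :
    (x' = x ∧ y' = y + 1) ∨ (x' = x - 1 ∧ y' = y) := by
  obtain ⟨e, h1, h2⟩ := h
  simp only [mem_rightEdges_faceZ, mem_leftEdges_faceZ, Prod.ext_iff] at h1 h2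
  omega

lemma pairwise_zString (y : ℤ) (K : ℕ) : (zString a c N y K).Nodup ∧
    (zString a c N y K).Pairwise fun L L' => ¬ LeftOf L' L := by
  induction K with
  | zero => simp [zString]
  | succ K ih =>
    rw [zString, List.nodup_cons, List.pairwise_cons]
    refine ⟨⟨fun h => ?_, ih.1⟩, fun L hL hLo => ?_, ih.2⟩
    · obtain ⟨x, -, h2, h3⟩ := mem_zString.1 h
      simp only [faceZ_inj, Prod.mk.injEq] at h3
      omega
    · obtain ⟨x, -, h2, rfl⟩ := mem_zString.1 hL
      have := leftOf_faceZ hLo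
      omega

lemma pairwise_zRows (T : ℕ) : (zRows a b c N T).Nodup ∧
    (zRows a b c N T).Pairwise fun L L' => ¬ LeftOf L' L := by
  induction T with
  | zero => simp [zRows]
  | succ T ih =>
    rw [zRows, List.nodup_append', List.pairwise_append]
    obtain ⟨h1, h2⟩ := pairwise_zString (a := a) (c := c) (N := N) (b - 1 - T) N
    refine ⟨⟨h1, ih.1, fun L hL hL' => ?_⟩, h2, ih.2, fun L hL L' hL' hLo => ?_⟩
    · obtain ⟨x, -, -, rfl⟩ := mem_zString.1 hL
      obtain ⟨x', y, -, -, h3, h4, h5⟩ := mem_zRows.1 hL'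
      simp only [faceZ_inj, Prod.mk.injEq] at h5
      omega
    · obtain ⟨x, -, -, rfl⟩ := mem_zString.1 hL
      obtain ⟨x', y, -, -, h3, h4, rfl⟩ := mem_zRows.1 hL'
      have := leftOf_faceZ hLo
      omega

/-- The faces of type `X` of the surface of the cube corner. -/
def cornerX (a b c : ℤ) (N : ℕ) : Set Lozenge :=
  {L | ∃ y z, y + 1 ≤ b ∧ z + 1 ≤ c ∧ b + c - 1 - N ≤ y + z ∧ L = faceX (a, y, z)}

/-- The faces of type `Y` of the surface of the cube corner. -/
def cornerY (a b c : ℤ) (N : ℕ) : Set Lozenge :=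
  {L | ∃ x z, x + 1 ≤ a ∧ z + 1 ≤ c ∧ a + c - 1 - N ≤ x + z ∧ L = faceY (x, b, z)}

lemma onX_cubes {x y z : ℤ} : OnX a b c N (cubes a b c N) x y z ↔
    x = a ∧ y + 1 ≤ b ∧ z + 1 ≤ c ∧ b + c - 1 - N ≤ y + z := by
  simp only [OnX, mem_cubes, IsBase]; omega

lemma onY_cubes {x y z : ℤ} : OnY a b c N (cubes a b c N) x y z ↔
    y = b ∧ x + 1 ≤ a ∧ z + 1 ≤ c ∧ a + c - 1 - N ≤ x + z := by
  simp only [OnY, mem_cubes, IsBase]; omega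

lemma onZ_cubes {x y z : ℤ} : OnZ a b c N (cubes a b c N) x y z ↔
    z = c ∧ a - N ≤ x ∧ x < a ∧ b - N ≤ y ∧ y < b := by
  simp only [OnZ, mem_cubes, IsBase, IsTop]; omega

lemma isLowerPile_cubes : IsLowerPile a b c N (cubes a b c N) :=
  ⟨subset_rfl, fun _ _ _ h _ => h⟩

/-- A reading of the surface of the cube corner: its faces of type `X`, the top rhombus, and its
faces of type `Y`. -/
lemma isReading_corner {lX lY : List Lozenge} (hX : IsReading (cornerX a b c N) lX)
    (hY : IsReading (cornerY a b c N) lY) :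
    IsReading (surfaceOf a b c N (cubes a b c N)) (lX ++ (zRows a b c N N ++ lY)) := by
  obtain ⟨hX1, hX2, hX3⟩ := hX
  obtain ⟨hY1, hY2, hY3⟩ := hY
  obtain ⟨hZ1, hZ3⟩ := pairwise_zRows (a := a) (b := b) (c := c) (N := N) N
  refine ⟨?_, ?_, ?_⟩
  · refine List.nodup_append'.2 ⟨hX1, List.nodup_append'.2 ⟨hZ1, hY1, ?_⟩, ?_⟩
    · intro L hL hL'
      obtain ⟨x, y, -, -, -, -, rfl⟩ := mem_zRows.1 hL
      obtain ⟨x', z', -, -, -, h⟩ := (hY2 _).1 hL'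
      exact faceY_ne_faceZ _ _ h.symm
    · intro L hL hL'
      obtain ⟨y, z, -, -, -, rfl⟩ := (hX2 _).1 hL
      obtain hL' | hL' := List.mem_append.1 hL'
      · obtain ⟨x', y', -, -, -, -, h⟩ := mem_zRows.1 hL'
        exact faceX_ne_faceZ _ _ h
      · obtain ⟨x', z', -, -, -, h⟩ := (hY2 _).1 hL'
        exact faceX_ne_faceY _ _ h
  · intro L
    rw [List.mem_append, List.mem_append, hX2, hY2, mem_zRows]
    constructor
    · rintro (⟨y, z, h1, h2, h3, rfl⟩ | ⟨x, y, h1, h2, h3, h4, rfl⟩ | ⟨x, z, h1, h2, h3, rfl⟩)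
      · exact faceX_mem_surfaceOf.2 (onX_cubes.2 ⟨rfl, h1, h2, h3⟩)
      · exact faceZ_mem_surfaceOf.2 (onZ_cubes.2 ⟨rfl, h1, h2, h3, h4⟩)
      · exact faceY_mem_surfaceOf.2 (onY_cubes.2 ⟨rfl, h1, h2, h3⟩)
    · rintro ⟨x, y, z, ⟨rfl, h⟩ | ⟨rfl, h⟩ | ⟨rfl, h⟩⟩
      · obtain ⟨rfl, h1, h2, h3⟩ := onX_cubes.1 h
        exact Or.inl ⟨y, z, h1, h2, h3, rfl⟩
      · obtain ⟨rfl, h1, h2, h3⟩ := onY_cubes.1 h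
        exact Or.inr (Or.inr ⟨x, z, h1, h2, h3, rfl⟩)
      · obtain ⟨rfl, h1, h2, h3, h4⟩ := onZ_cubes.1 h
        exact Or.inr (Or.inl ⟨x, y, h1, h2, h3, h4, rfl⟩)
  · refine List.pairwise_append.2 ⟨hX3, List.pairwise_append.2 ⟨hZ3, hY3, ?_⟩, ?_⟩
    · rintro L hL L' hL' ⟨e, h1, h2⟩
      obtain ⟨x, y, -, -, -, hy, rfl⟩ := mem_zRows.1 hL
      obtain ⟨x', z', -, -, -, rfl⟩ := (hY2 _).1 hL'
      simp only [mem_rightEdges_faceY, mem_leftEdges_faceZ, Prod.ext_iff] at h1 h2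
      omega
    · rintro L hL L' hL' ⟨e, h1, h2⟩
      obtain ⟨y, z, hy, hz, -, rfl⟩ := (hX2 _).1 hL
      obtain hL' | hL' := List.mem_append.1 hL'
      · obtain ⟨x', y', -, -, -, -, rfl⟩ := mem_zRows.1 hL'
        simp only [mem_rightEdges_faceZ, mem_leftEdges_faceX, Prod.ext_iff] at h1 h2
        omega
      · obtain ⟨x', z', -, -, -, rfl⟩ := (hY2 _).1 hL'
        simp only [mem_rightEdges_faceY, mem_leftEdges_faceX, Prod.ext_iff] at h1 h2
        omega

end

/-! ### The minor of the cube corner -/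

section
variable {A : Type*} [CommRing A] {a b c : ℤ} {N : ℕ} {τ : Pt → Aˣ}

/-- The faces of type `Y` only change entries of index less than `2N` by entries that vanish. -/
lemma act_cornerY (l : List Lozenge) (hl : ∀ L ∈ l, L ∈ cornerY a b c N) :
    act a b c N τ l (unitRows A N) = unitRows A N := by
  induction l with
  | nil => rfl
  | cons L l ih =>
    rw [act_cons, ih fun L' hL' => hl L' (List.mem_cons_of_mem _ hL')]
    obtain ⟨x, z, h1, h2, h3, rfl⟩ := hl L List.mem_cons_self
    have hlev : level a b c N (faceY (x, b, z)).left + 1 ≤ 2 * N := by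
      simp only [faceY_mk, level]; omega
    have h0 : ∀ j : ℤ, j ≤ 2 * N → unitRows A N j = 0 := by
      intro j hj
      funext s
      simp only [unitRows, Pi.zero_apply, ite_eq_right_iff]
      omega
    rw [lozengeStep, rowStep, h0 _ hlev, h0 _ (by omega), smul_zero, smul_zero, add_zero,
      ← h0 (level a b c N (faceY (x, b, z)).left) (by omega), Function.update_eq_self]

/-- The effect of row `r` of the top rhombus, counted from the front: to the entries it changes, which
used to vanish from the `r`-th coordinate on, it adds a multiple of the `r`-th unit vector, up to
earlier coordinates. The factors telescope. -/
lemma act_zString {r : Fin N} {g : ℤ → Fin N → A}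
    (h1 : g (2 * N + r + 1) = unitRows A N (2 * N + r + 1))
    (h2 : ∀ j : ℤ, N + r < j → j ≤ 2 * N + r → ∀ s, r ≤ s → g j s = 0) (K : ℕ) (hK : K ≤ N) :
    ∀ j : ℤ, (2 * N - K + r < j ∧ j ≤ 2 * N + r + 1 →
        (∀ s, r < s → act a b c N τ (zString a c N (b - 1 - r) K) g j s = 0) ∧
        act a b c N τ (zString a c N (b - 1 - r) K) g j r =
          ((τ (a - N + (2 * N + r + 1 - j), b - r, c) / τ (a - N, b - r, c) : Aˣ) : A)) ∧
      (j ≤ 2 * N - K + r ∨ 2 * N + r + 1 < j →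
        act a b c N τ (zString a c N (b - 1 - r) K) g j = g j) := by
  induction K with
  | zero =>
    intro j
    refine ⟨fun hj => ?_, fun _ => rfl⟩
    obtain rfl : j = 2 * N + r + 1 := by push_cast at hj; omega
    rw [zString, act_nil, h1]
    refine ⟨fun s hs => ?_, ?_⟩
    · simp only [unitRows, ite_eq_right_iff]
      intro h
      have : (r : ℕ) < s := hs
      omega
    · simp [unitRows]
  | succ K ih =>
    specialize ih (by omega)
    have hlev : level a b c N (faceZ (a - N + K, b - 1 - r, c)).left = 2 * N - K + r := by
      simp only [faceZ_mk, level]; ring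
    intro j
    rw [zString, act_cons, lozengeStep, rowStep, hlev]
    push_cast
    by_cases hj : j = 2 * N - K + r
    · refine ⟨fun _ => ?_, fun h => by omega⟩
      subst hj
      obtain ⟨h3, h4⟩ := (ih (2 * N - K + r + 1)).1 (by omega)
      have h5 := (ih (2 * N - K + r)).2 (by omega)
      rw [Function.update_self, h5]
      refine ⟨fun s hs => ?_, ?_⟩
      · simp only [Pi.add_apply, Pi.smul_apply, smul_eq_mul]
        rw [h2 _ (by omega) (by omega) s hs.le, h3 s hs, mul_zero, mul_zero, add_zero]
      · simp only [Pi.add_apply, Pi.smul_apply, smul_eq_mul]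
        rw [h2 _ (by omega) (by omega) r le_rfl, h4, mul_zero, zero_add, ← Units.val_mul]
        have e1 : a - N + (2 * N + r + 1 - (2 * N - K + r + 1)) = a - N + (K : ℤ) := by ring
        have e2 : a - N + (2 * N + r + 1 - (2 * N - K + r)) = a - N + (K : ℤ) + 1 := by ring
        have e3 : b - 1 - (r : ℤ) + 1 = b - r := by ring
        rw [faceZ_mk, e1, e2]
        simp only [e3]
        rw [div_mul_div_cancel]
    · rw [Function.update_of_ne hj]
      exact ⟨fun h => (ih j).1 (by omega), fun h => (ih j).2 (by omega)⟩

/-- The effect of the `T` rows of the top rhombus nearest to the apex: the rows `N + 1, …, N + T` have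
reached their final lower triangular form. -/
lemma act_zRows (T : ℕ) (hT : T ≤ N) :
    (∀ j : ℤ, 2 * N + T < j → act a b c N τ (zRows a b c N T) (unitRows A N) j =
      unitRows A N j) ∧
    (∀ j : ℤ, N + T < j → j ≤ 2 * N + T → ∀ s : Fin N, T ≤ (s : ℕ) →
      act a b c N τ (zRows a b c N T) (unitRows A N) j s = 0) ∧
    (∀ r : Fin N, (r : ℕ) < T →
      (∀ s, r < s → act a b c N τ (zRows a b c N T) (unitRows A N) (N + r + 1) s = 0) ∧
      act a b c N τ (zRows a b c N T) (unitRows A N) (N + r + 1) r =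
        ((τ (a, b - r, c) / τ (a - N, b - r, c) : Aˣ) : A)) := by
  induction T with
  | zero =>
    refine ⟨fun j _ => rfl, fun j _ hj s _ => ?_, fun r hr => absurd hr (by omega)⟩
    simp only [zRows, act_nil, unitRows, ite_eq_right_iff]
    push_cast at hj
    omega
  | succ T ih =>
    obtain ⟨h1, h2, h3⟩ := ih (by omega)
    set g := act a b c N τ (zRows a b c N T) (unitRows A N) with hg
    have H := act_zString (a := a) (b := b) (c := c) (τ := τ) (r := ⟨T, hT⟩) (g := g)
      (h1 _ (by simp)) (fun j hj hj' s hs => h2 j hj hj' s hs) N le_rfl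
    rw [zRows, act_append, ← hg]
    simp only at H
    push_cast
    refine ⟨fun j hj => ?_, fun j hj hj' s hs => ?_, fun r hr => ?_⟩
    · rw [(H j).2 (by omega), h1 j (by omega)]
    · exact ((H j).1 (by omega)).1 s (by rw [Fin.lt_def]; simp only; omega)
    · by_cases hrT : (r : ℕ) = T
      · obtain rfl : r = ⟨T, hT⟩ := Fin.ext hrT
        obtain ⟨h4, h5⟩ := (H (N + T + 1)).1 (by omega)
        refine ⟨h4, ?_⟩
        simp only
        rw [h5, show a - N + (2 * N + T + 1 - (N + T + 1)) = a by ring]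
      · rw [(H (N + r + 1)).2 (by omega)]
        exact h3 r (by omega)

lemma windowDet_zRows : windowDet N (act a b c N τ (zRows a b c N N) (unitRows A N)) =
    ((∏ r ∈ Finset.range N, τ (a, b - r, c) / τ (a - N, b - r, c) : Aˣ) : A) := by
  have h := (act_zRows (A := A) (a := a) (b := b) (c := c) (τ := τ) N le_rfl).2.2
  rw [windowDet, Matrix.det_of_isLowerTriangular, Finset.prod_range, Units.coe_prod]
  · exact Finset.prod_congr rfl fun r _ => (h r r.2).2
  · exact fun r s hrs => (h r r.2).1 s hrs

lemma windowDet_rowStep {i : ℤ} (hi : i + 1 ≤ 2 * N) (d u : A) (f : ℤ → Fin N → A) :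
    windowDet N (rowStep i d u f) = (if (N : ℤ) + 1 ≤ i then d else 1) * windowDet N f := by
  unfold windowDet
  split_ifs with h
  · obtain ⟨p, rfl⟩ : ∃ p : ℕ, i = N + p + 1 := ⟨(i - N - 1).toNat, by omega⟩
    have hp : p + 1 < N := by omega
    let r : Fin N := ⟨p, by omega⟩
    let r' : Fin N := ⟨p + 1, hp⟩
    set M : Matrix (Fin N) (Fin N) A := Matrix.of fun r => f (N + r + 1) with hM
    have e : (Matrix.of fun s : Fin N => rowStep ((N : ℤ) + p + 1) d u f (N + s + 1)) =
        M.updateRow r (d • M r + u • M r') := by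
      ext s t
      by_cases hs : s = r
      · subst hs
        have : (N : ℤ) + p + 1 + 1 = N + ((p + 1 : ℕ) : ℤ) + 1 := by push_cast; ring
        simp [rowStep, r, r', hM, this]
      · have : (N : ℤ) + s + 1 ≠ N + p + 1 := fun h' => hs (Fin.ext (by simp only [r]; omega))
        simp [rowStep, hM, hs, this]
    have hne : r' ≠ r := by simp [r, r', Fin.ext_iff]
    rw [e, Matrix.det_updateRow_add, Matrix.det_updateRow_smul, Matrix.det_updateRow_smul,
      Matrix.updateRow_eq_self, Matrix.det_updateRow_eq_zero hne, mul_zero, add_zero]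
  · rw [one_mul]
    congr 1
    ext s t
    have : (N : ℤ) + s + 1 ≠ i := by omega
    simp [rowStep, this]

/-- Each face of type `X` at a level above `N` multiplies the determinant of the window by the first
diagonal entry of its block, since the other entry adds a multiple of the next row; the faces at
lower levels only change rows outside the window. -/
lemma windowDet_act_cornerX (l : List Lozenge) (hl : ∀ L ∈ l, L ∈ cornerX a b c N)
    (f : ℤ → Fin N → A) :
    windowDet N (act a b c N τ l f) = (((l.map fun L =>
      if (N : ℤ) + 1 ≤ level a b c N L.left then τ L.left / τ L.right else 1).prod : Aˣ) : A) *
        windowDet N f := by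
  induction l with
  | nil => simp
  | cons L l ih =>
    obtain ⟨y, z, h1, h2, h3, hL⟩ := hl L List.mem_cons_self
    have hlev : level a b c N L.left + 1 ≤ 2 * N := by
      simp only [hL, faceX_mk, level]; omega
    rw [act_cons, lozengeStep, windowDet_rowStep hlev,
      ih fun L' hL' => hl L' (List.mem_cons_of_mem _ hL'), List.map_cons, List.prod_cons,
      Units.val_mul, mul_assoc]
    congr 1
    split_ifs <;> simp

/-- The factors of the faces of type `X` telescope along each level above `N`, from the West border
up to the top edge of the corner. -/
lemma prod_cornerX {l : List Lozenge} (hl : IsReading (cornerX a b c N) l) :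
    (l.map fun L => if (N : ℤ) + 1 ≤ level a b c N L.left then τ L.left / τ L.right else 1).prod =
      ∏ k ∈ Finset.range (N - 1), τ (west a b c N (N + 2 + k)) / τ (a, b - 1 - k, c) := by
  classical
  -- the vertices along the level `N + 1 + k`, from the West border on
  let q : ℕ → ℕ → Pt := fun k t =>
    (a, b - ((N : ℤ) + 2 + k) / 2 + t, c - N + ((N : ℤ) + 1 + k) / 2 + t)
  let n : ℕ → ℕ := fun k => N - (N + 1 + k) / 2
  have htel : ∀ k ∈ Finset.range (N - 1), τ (west a b c N (N + 2 + k)) / τ (a, b - 1 - k, c) =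
      ∏ t ∈ Finset.range (n k), τ (q k t) / τ (q k (t + 1)) := by
    intro k hk
    rw [Finset.mem_range] at hk
    rw [Finset.prod_range_div' (fun t => τ (q k t))]
    have h1 : west a b c N (N + 2 + k) = q k 0 := by
      rw [west, if_pos (by omega)]
      simp only [q, Prod.mk.injEq, true_and]
      push_cast
      omega
    have h2 : (a, b - 1 - (k : ℤ), c) = q k (n k) := by
      simp only [q, n, Prod.mk.injEq, true_and]
      omega
    rw [h1, h2]
  rw [Finset.prod_congr rfl htel, ← List.prod_toFinset _ hl.1, ← Finset.prod_filter,
    Finset.prod_sigma']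
  symm
  refine Finset.prod_bij (fun p _ => faceX (q p.1 p.2)) ?_ ?_ ?_ ?_
  · rintro ⟨k, t⟩ h
    simp only [Finset.mem_sigma, Finset.mem_range, n] at h
    rw [Finset.mem_filter, List.mem_toFinset, hl.2.1]
    refine ⟨⟨_, _, ?_, ?_, ?_, rfl⟩, ?_⟩
    · simp only; omega
    · simp only; omega
    · simp only; omega
    · simp only [q, faceX_mk, level]; omega
  · rintro ⟨k, t⟩ h ⟨k', t'⟩ h' he
    simp only [faceX_inj, q, Prod.mk.injEq, true_and] at he
    simp only [Finset.mem_sigma, Finset.mem_range, n] at h h'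
    obtain rfl : k = k' := by omega
    obtain rfl : t = t' := by omega
    rfl
  · intro L hL
    rw [Finset.mem_filter, List.mem_toFinset, hl.2.1] at hL
    obtain ⟨⟨y, z, h1, h2, h3, rfl⟩, h4⟩ := hL
    simp only [faceX_mk, level] at h4
    obtain ⟨k, hk⟩ : ∃ k : ℕ, (k : ℤ) = z - y - c + b - 1 := ⟨(z - y - c + b - 1).toNat, by omega⟩
    obtain ⟨t, ht⟩ : ∃ t : ℕ, (t : ℤ) = y - (b - ((N : ℤ) + 2 + k) / 2) :=
      ⟨(y - (b - ((N : ℤ) + 2 + k) / 2)).toNat, by omega⟩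
    refine ⟨⟨k, t⟩, ?_, ?_⟩
    · simp only [Finset.mem_sigma, Finset.mem_range, n]
      omega
    · simp only [faceX_inj, q, Prod.mk.injEq, true_and]
      omega
  · rintro ⟨k, t⟩ h
    simp only [q, faceX_mk]
    push_cast
    simp only [add_assoc]

/-- The minor of the surface of the cube corner is a monomial in the labels of its border. -/
lemma cornerMinor_corner {l : List Lozenge}
    (hl : IsReading (surfaceOf a b c N (cubes a b c N)) l) :
    cornerMinor N (readingMatrix a b c N τ l) =
      (((∏ k ∈ Finset.range (N - 1), τ (west a b c N (N + 2 + k)) / τ (a, b - 1 - k, c)) *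
        ∏ r ∈ Finset.range N, τ (a, b - r, c) / τ (a - N, b - r, c) : Aˣ) : A) := by
  have hsub : ∀ {S : Set Lozenge}, S ⊆ surfaceOf a b c N (cubes a b c N) →
      ∃ l, IsReading S l := fun hS =>
    exists_isReading ((finite_surfaceOf isLowerPile_cubes).subset hS)
      fun L hL => isFace_of_mem_surfaceOf (hS hL)
  obtain ⟨lX, hX⟩ := hsub (S := cornerX a b c N) (by
    rintro _ ⟨y, z, h1, h2, h3, rfl⟩
    exact faceX_mem_surfaceOf.2 (onX_cubes.2 ⟨rfl, h1, h2, h3⟩))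
  obtain ⟨lY, hY⟩ := hsub (S := cornerY a b c N) (by
    rintro _ ⟨y, z, h1, h2, h3, rfl⟩
    exact faceY_mem_surfaceOf.2 (onY_cubes.2 ⟨rfl, h1, h2, h3⟩))
  rw [cornerMinor_readingMatrix, act_eq_of_isReading isLowerPile_cubes hl (isReading_corner hX hY),
    act_append, act_append, act_cornerY lY fun L hL => (hY.2.1 L).1 hL,
    windowDet_act_cornerX lX fun L hL => (hX.2.1 L).1 hL, windowDet_zRows, prod_cornerX hX,
    Units.val_mul]

end

/-! ### The formula for the apex -/

section
variable {A : Type*} [CommRing A] {a b c : ℤ} {N : ℕ} {τ : Pt → Aˣ}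

/-- The prefactor cancels the monomial of the cube corner except for the label of the apex. -/
lemma apex_eq (hN : 1 ≤ N) :
    (∏ i ∈ Finset.Icc (N + 2) (2 * N), (τ (west a b c N i))⁻¹) *
      (∏ j ∈ Finset.Icc (2 * N + 1) (3 * N), τ (east a b c N j)) *
      ((∏ k ∈ Finset.range (N - 1), τ (west a b c N (N + 2 + k)) / τ (a, b - 1 - k, c)) *
        ∏ r ∈ Finset.range N, τ (a, b - r, c) / τ (a - N, b - r, c)) = τ (a, b, c) := by
  have h1 : ∏ i ∈ Finset.Icc (N + 2) (2 * N), (τ (west a b c N i))⁻¹ =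
      ∏ k ∈ Finset.range (N - 1), (τ (west a b c N (N + 2 + k)))⁻¹ := by
    rw [show Finset.Icc (N + 2) (2 * N) = Finset.Ico (N + 2) (2 * N + 1) by rfl,
      Finset.prod_Ico_eq_prod_range, show 2 * N + 1 - (N + 2) = N - 1 by omega]
  have h2 : ∏ j ∈ Finset.Icc (2 * N + 1) (3 * N), τ (east a b c N j) =
      ∏ r ∈ Finset.range N, τ (a - N, b - r, c) := by
    rw [show Finset.Icc (2 * N + 1) (3 * N) = Finset.Ico (2 * N + 1) (3 * N + 1) by rfl,
      Finset.prod_Ico_eq_prod_range, show 3 * N + 1 - (2 * N + 1) = N by omega]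
    refine Finset.prod_congr rfl fun r _ => ?_
    congr 1
    unfold east
    split_ifs with h
    · obtain rfl : r = 0 := by omega
      simp only [Prod.mk.injEq]
      push_cast
      omega
    · simp
  rw [h1, h2, Finset.prod_div_distrib, Finset.prod_div_distrib, Finset.prod_inv_distrib]
  obtain ⟨n, rfl⟩ : ∃ n, N = n + 1 := ⟨N - 1, by omega⟩
  rw [Finset.prod_range_succ' (fun r : ℕ => τ (a, b - r, c)), add_tsub_cancel_right]
  have h3 : ∀ k : ℕ, b - ((k + 1 : ℕ) : ℤ) = b - 1 - k := fun k => by push_cast; ring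
  simp only [h3, Nat.cast_zero, sub_zero]
  generalize ∏ k ∈ Finset.range n, τ (a, b - 1 - k, c) = P
  generalize ∏ r ∈ Finset.range (n + 1), τ (a - (n + 1 : ℕ), b - r, c) = Q
  generalize ∏ k ∈ Finset.range n, τ (west a b c (n + 1) (n + 1 + 2 + k)) = W
  rw [div_eq_mul_inv, div_eq_mul_inv]
  calc W⁻¹ * Q * (W * P⁻¹ * (P * τ (a, b, c) * Q⁻¹))
      = (W⁻¹ * W) * (Q * Q⁻¹) * (P⁻¹ * P) * τ (a, b, c) := by ac_rfl
    _ = τ (a, b, c) := by simp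

end

/-! ### Evaporated configurations -/

section
variable {a b c : ℤ} {N : ℕ}

/-- The set of evaporated cubes, as a set of cubes of the corner that contains with a cube all the
cubes of the corner immediately above it. -/
structure IsUpperPile (a b c : ℤ) (E : Set Pt) : Prop where
  bound : ∀ x y z, (x, y, z) ∈ E → x < a ∧ y < b ∧ z < c
  upper : ∀ x y z, (x, y, z) ∈ E → (x + 1 < a → (x + 1, y, z) ∈ E) ∧
    (y + 1 < b → (x, y + 1, z) ∈ E) ∧ (z + 1 < c → (x, y, z + 1) ∈ E)

/-- The surface left after the evaporation of a set of cubes. -/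
structure IsMelted (a b c : ℤ) (E : Set Pt) (G : Set Lozenge) : Prop where
  faceX_mem : ∀ x y z, faceX (x, y, z) ∈ G ↔
    (x - 1, y, z) ∉ E ∧ ((x, y, z) ∈ E ∨ x = a ∧ y < b ∧ z < c)
  faceY_mem : ∀ x y z, faceY (x, y, z) ∈ G ↔
    (x, y - 1, z) ∉ E ∧ ((x, y, z) ∈ E ∨ y = b ∧ x < a ∧ z < c)
  faceZ_mem : ∀ x y z, faceZ (x, y, z) ∈ G ↔
    (x, y, z - 1) ∉ E ∧ ((x, y, z) ∈ E ∨ z = c ∧ x < a ∧ y < b)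

/-- Evaporation of a cube with no evaporated cube immediately below it. -/
lemma IsMelted.melt {E : Set Pt} {G : Set Lozenge} (hM : IsMelted a b c E G) {x y z : ℤ}
    (hb : (x - 1, y, z) ∉ E ∧ (x, y - 1, z) ∉ E ∧ (x, y, z - 1) ∉ E) :
    IsMelted a b c (insert (x, y, z) E) ((G \ topFaces (x, y, z)) ∪ bottomFaces (x, y, z)) := by
  refine ⟨?_, ?_, ?_⟩
  · intro x' y' z'
    simp only [Set.mem_union, Set.mem_sdiff, hM.faceX_mem, mem_bottomFaces, mem_topFaces,
      faceX_inj, faceX_ne_faceY, faceX_ne_faceZ, Set.mem_insert_iff, or_false]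
    by_cases e : (x', y', z') = (x, y, z)
    · cases e
      simp [hb.1]
    · have e' : (x' - 1, y', z') = (x, y, z) ↔ (x', y', z') = (x + 1, y, z) := by
        simp only [Prod.mk.injEq]; omega
      simp only [e, e', false_or, or_false, not_or]
      clear hM hb e'
      tauto
  · intro x' y' z'
    simp only [Set.mem_union, Set.mem_sdiff, hM.faceY_mem, mem_bottomFaces, mem_topFaces,
      faceY_inj, (faceX_ne_faceY _ _).symm, faceY_ne_faceZ, Set.mem_insert_iff, or_false,
      false_or]
    by_cases e : (x', y', z') = (x, y, z)
    · cases e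
      simp [hb.2.1]
    · have e' : (x', y' - 1, z') = (x, y, z) ↔ (x', y', z') = (x, y + 1, z) := by
        simp only [Prod.mk.injEq]; omega
      simp only [e, e', false_or, or_false, not_or]
      clear hM hb e'
      tauto
  · intro x' y' z'
    simp only [Set.mem_union, Set.mem_sdiff, hM.faceZ_mem, mem_bottomFaces, mem_topFaces,
      faceZ_inj, (faceX_ne_faceZ _ _).symm, (faceY_ne_faceZ _ _).symm, Set.mem_insert_iff,
      false_or]
    by_cases e : (x', y', z') = (x, y, z)
    · cases e
      simp [hb.2.2]
    · have e' : (x', y', z' - 1) = (x, y, z) ↔ (x', y', z') = (x, y, z + 1) := by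
        simp only [Prod.mk.injEq]; omega
      simp only [e, e', false_or, or_false, not_or]
      clear hM hb e'
      tauto

lemma Evaporated.isMelted {E : Set Pt} {G : Set Lozenge} (h : Evaporated a b c E G) :
    IsUpperPile a b c E ∧ IsMelted a b c E G := by
  induction h with
  | corner =>
    refine ⟨⟨fun _ _ _ h => h.elim, fun _ _ _ h => h.elim⟩, ⟨?_, ?_, ?_⟩⟩ <;> intro x y z <;>
      simp only [cornerSurface, Set.mem_ofPred_eq, Set.mem_empty_iff_false, not_false_eq_true,
        true_and, false_or, faceX_inj, faceY_inj, faceZ_inj, faceX_ne_faceY, faceX_ne_faceZ,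
        faceY_ne_faceZ, (faceX_ne_faceY _ _).symm, (faceX_ne_faceZ _ _).symm,
        (faceY_ne_faceZ _ _).symm, and_false, exists_false, or_false, Prod.mk.injEq]
    · exact ⟨fun ⟨_, _, h1, h2, h3, rfl, rfl⟩ => ⟨h3, h1, h2⟩,
        fun ⟨h3, h1, h2⟩ => ⟨_, _, h1, h2, h3, rfl, rfl⟩⟩
    · exact ⟨fun ⟨_, _, h1, h2, h3, h4, h5⟩ => by subst h3 h5; exact ⟨h4, h1, h2⟩,
        fun ⟨h3, h1, h2⟩ => ⟨_, _, h1, h2, rfl, h3, rfl⟩⟩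
    · exact ⟨fun ⟨_, _, h1, h2, h3, h4, h5⟩ => by subst h3 h4; exact ⟨h5, h1, h2⟩,
        fun ⟨h3, h1, h2⟩ => ⟨_, _, h1, h2, rfl, rfl, h3⟩⟩
  | @melt E G p hG hp ih =>
    obtain ⟨hU, hM⟩ := ih
    obtain ⟨x, y, z⟩ := p
    have hX := (hM.faceX_mem _ _ _).1 (hp (mem_topFaces.2 (Or.inl rfl)))
    have hY := (hM.faceY_mem _ _ _).1 (hp (mem_topFaces.2 (Or.inr (Or.inl rfl))))
    have hZ := (hM.faceZ_mem _ _ _).1 (hp (mem_topFaces.2 (Or.inr (Or.inr rfl))))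
    rw [add_sub_cancel_right] at hX hY hZ
    have hn := hX.1
    have hb : x < a ∧ y < b ∧ z < c := by
      refine ⟨?_, ?_, ?_⟩
      · obtain h1 | h1 := hX.2
        · have := hU.bound _ _ _ h1; omega
        · omega
      · obtain h1 | h1 := hY.2
        · have := hU.bound _ _ _ h1; omega
        · omega
      · obtain h1 | h1 := hZ.2
        · have := hU.bound _ _ _ h1; omega
        · omega
    -- the cubes below an unevaporated cube are unevaporated
    have hbelow : (x - 1, y, z) ∉ E ∧ (x, y - 1, z) ∉ E ∧ (x, y, z - 1) ∉ E := by
      refine ⟨fun h => hn ?_, fun h => hn ?_, fun h => hn ?_⟩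
      · simpa using (hU.upper _ _ _ h).1 (by omega)
      · simpa using (hU.upper _ _ _ h).2.1 (by omega)
      · simpa using (hU.upper _ _ _ h).2.2 (by omega)
    refine ⟨⟨?_, ?_⟩, hM.melt hbelow⟩
    · rintro x' y' z' (h | h)
      · cases h; exact hb
      · exact hU.bound _ _ _ h
    · rintro x' y' z' (h | h)
      · cases h
        refine ⟨fun h => Or.inr (hX.2.resolve_right (by omega)),
          fun h => Or.inr (hY.2.resolve_right (by omega)),
          fun h => Or.inr (hZ.2.resolve_right (by omega))⟩
      · have := hU.upper _ _ _ h
        exact ⟨fun h => Or.inr (this.1 h), fun h => Or.inr (this.2.1 h),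
          fun h => Or.inr (this.2.2 h)⟩

lemma Evaporated.finite {E : Set Pt} {G : Set Lozenge} (h : Evaporated a b c E G) : E.Finite := by
  induction h with
  | corner => exact Set.finite_empty
  | melt _ _ ih => exact ih.insert _

/-- Finitely many cubes of the corner lie in `Q_N` for all large `N`. -/
lemma exists_subset_cubes {E : Set Pt} (hU : IsUpperPile a b c E) (hE : E.Finite) :
    ∃ N₀ : ℕ, ∀ N : ℕ, N₀ ≤ N → E ⊆ cubes a b c N := by
  obtain ⟨M, hM⟩ := (hE.image time).bddBelow
  refine ⟨(a + b + c - 2 - M).toNat, fun N hN => ?_⟩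
  rintro ⟨x, y, z⟩ h
  have h1 : M ≤ x + y + z := hM ⟨_, h, rfl⟩
  have h2 := hU.bound _ _ _ h
  exact mem_cubes.2 (by omega)

/-- Every pile of cubes can be built up cube by cube. -/
lemma IsLowerPile.intermediateSurface {Λ : Set Pt} (h : IsLowerPile a b c N Λ) :
    IntermediateSurface a b c N Λ (surfaceOf a b c N Λ) := by
  have hfin : Λ.Finite := (finite_cubes a b c N).subset h.subset
  induction hk : Λ.ncard using Nat.strong_induction_on generalizing Λ with
  | _ k ih =>
    obtain rfl | hne := Λ.eq_empty_or_nonempty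
    · rw [← augmentedShadow_eq]
      exact IntermediateSurface.flat
    -- a cube of greatest time is the last one added
    obtain ⟨⟨x, y, z⟩, hp, hmax⟩ := Set.exists_max_image Λ time hfin hne
    set Λ' := Λ \ {(x, y, z)} with hΛ'
    have hins : insert (x, y, z) Λ' = Λ := by simp [hΛ', hp]
    have hn : (x, y, z) ∉ Λ' := fun h' => h'.2 rfl
    have hlow : IsLowerPile a b c N Λ' := by
      refine ⟨Set.sdiff_subset.trans h.subset, fun x' y' z' hq hor => ⟨h.lower _ _ _ hq ?_, ?_⟩⟩
      · exact hor.imp And.left (Or.imp And.left And.left)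
      · intro he
        cases he
        obtain h1 | h1 | h1 := hor <;> have := hmax _ h1.1 <;> simp only [time] at this <;> omega
    have hp' := mem_cubes.1 (h.subset hp)
    have hmem : ∀ x' y' z', (x', y', z') ∈ cubes a b c N → x' + y' + z' < x + y + z →
        (x' + 1, y', z') = (x, y, z) ∨ (x', y' + 1, z') = (x, y, z) ∨
          (x', y', z' + 1) = (x, y, z) → (x', y', z') ∈ Λ' := by
      intro x' y' z' hq hlt hor
      refine ⟨h.lower _ _ _ hq ?_, fun he => ?_⟩
      · obtain h1 | h1 | h1 := hor <;> simp only [h1, hp, true_or, or_true]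
      · simp only [Set.mem_singleton_iff, Prod.mk.injEq] at he
        omega
    have hb : bottomFaces (x, y, z) ⊆ surfaceOf a b c N Λ' := by
      intro L hL
      by_cases hbase : IsBase a b c N x y z
      · obtain rfl | rfl | rfl := mem_bottomFaces.1 hL
        exacts [faceX_mem_surfaceOf.2 ⟨hn, Or.inl hbase⟩,
          faceY_mem_surfaceOf.2 ⟨hn, Or.inl hbase⟩, faceZ_mem_surfaceOf.2 ⟨hn, Or.inl hbase⟩]
      · simp only [IsBase] at hbase
        obtain rfl | rfl | rfl := mem_bottomFaces.1 hL
        · exact faceX_mem_surfaceOf.2 ⟨hn, Or.inr (hmem _ _ _ (mem_cubes.2 (by omega))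
            (by omega) (by simp))⟩
        · exact faceY_mem_surfaceOf.2 ⟨hn, Or.inr (hmem _ _ _ (mem_cubes.2 (by omega))
            (by omega) (by simp))⟩
        · exact faceZ_mem_surfaceOf.2 ⟨hn, Or.inr (Or.inl (hmem _ _ _ (mem_cubes.2 (by omega))
            (by omega) (by simp)))⟩
    have hcard : Λ'.ncard < k := hk ▸ Set.ncard_sdiff_singleton_lt_of_mem hp hfin
    have := (ih _ hcard hlow (hfin.subset Set.sdiff_subset) rfl).add hb
    rwa [surfaceOf_insert hlow (h.subset hp) hn, hins] at this

lemma IsUpperPile.isLowerPile_sdiff {E : Set Pt} (hU : IsUpperPile a b c E) :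
    IsLowerPile a b c N (cubes a b c N \ E) := by
  refine ⟨Set.sdiff_subset, fun x y z hq hor => ⟨hq, fun hE => ?_⟩⟩
  have h := hU.upper _ _ _ hE
  obtain ⟨h1, h2⟩ | ⟨h1, h2⟩ | ⟨h1, h2⟩ := hor <;> have := mem_cubes.1 h1
  exacts [h2 (h.1 (by omega)), h2 (h.2.1 (by omega)), h2 (h.2.2 (by omega))]

lemma IsMelted.surfaceOf_subset {E : Set Pt} {G : Set Lozenge} (hM : IsMelted a b c E G)
    (hE : E ⊆ cubes a b c N) : surfaceOf a b c N (cubes a b c N \ E) ⊆ G := by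
  have hc : ∀ {x y z : ℤ}, (x, y, z) ∈ E → _ := fun h => mem_cubes.1 (hE h)
  have hn : ∀ {x y z : ℤ}, (x, y, z) ∈ cubes a b c N → (x, y, z) ∉ cubes a b c N \ E →
      (x, y, z) ∈ E := fun h1 h2 => by_contra fun h3 => h2 ⟨h1, h3⟩
  rintro L ⟨x, y, z, ⟨rfl, h1, h2⟩ | ⟨rfl, h1, h2⟩ | ⟨rfl, h1, h2⟩⟩
  · refine (hM.faceX_mem _ _ _).2 ?_
    obtain h2 | ⟨h2, h3⟩ := h2
    · simp only [IsBase] at h2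
      exact ⟨fun h => by have := hc h; omega, Or.inl (hn (mem_cubes.2 (by omega)) h1)⟩
    · have h2 := mem_cubes.1 h2
      refine ⟨h3, ?_⟩
      by_cases hx : x = a
      · exact Or.inr (by omega)
      · exact Or.inl (hn (mem_cubes.2 (by omega)) h1)
  · refine (hM.faceY_mem _ _ _).2 ?_
    obtain h2 | ⟨h2, h3⟩ := h2
    · simp only [IsBase] at h2
      exact ⟨fun h => by have := hc h; omega, Or.inl (hn (mem_cubes.2 (by omega)) h1)⟩
    · have h2 := mem_cubes.1 h2
      refine ⟨h3, ?_⟩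
      by_cases hx : y = b
      · exact Or.inr (by omega)
      · exact Or.inl (hn (mem_cubes.2 (by omega)) h1)
  · refine (hM.faceZ_mem _ _ _).2 ?_
    obtain h2 | ⟨h2, h3⟩ | h2 := h2
    · simp only [IsBase] at h2
      exact ⟨fun h => by have := hc h; omega, Or.inl (hn (mem_cubes.2 (by omega)) h1)⟩
    · have h2 := mem_cubes.1 h2
      refine ⟨h3, ?_⟩
      by_cases hx : z = c
      · exact Or.inr (by omega)
      · exact Or.inl (hn (mem_cubes.2 (by omega)) h1)
    · simp only [IsTop] at h2
      exact ⟨fun h => by have := hc h; omega, Or.inr (by omega)⟩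

end
end CubeCorner

theorem mainTheorem3 {A : Type*} [CommRing A] (a b c : ℤ) :
    (∀ (N : ℕ), 1 ≤ N → ∀ (Λ : Set Pt) (F : Set Lozenge), IntermediateSurface a b c N Λ F →
      (∃ l : List Lozenge, IsReading F l) ∧
      ∀ θ τ : Pt → Aˣ,
        (∀ p ∈ cubes a b c N, p ∉ Λ → CubeRelation θ p) →
        (∀ p, baseTime a b c N ≤ time p → τ p = θ p) →
        ∀ l : List Lozenge, IsReading F l →
          (θ (a, b, c) : A) =
            (((∏ i ∈ Finset.Icc (N + 2) (2 * N), (τ (west a b c N i))⁻¹) *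
              ∏ j ∈ Finset.Icc (2 * N + 1) (3 * N), τ (east a b c N j) : Aˣ) : A) *
              cornerMinor N (readingMatrix a b c N τ l)) ∧
    (∀ (E : Set Pt) (G : Set Lozenge), Evaporated a b c E G →
      ∃ N₀ : ℕ, ∀ N : ℕ, N₀ ≤ N → E ⊆ cubes a b c N ∧
        ∃ F : Set Lozenge, IntermediateSurface a b c N (cubes a b c N \ E) F ∧ F ⊆ G) := by
  constructor
  · intro N hN Λ F hF
    obtain ⟨hΛ, rfl⟩ := hF.eq_surfaceOf
    refine ⟨exists_isReading_surfaceOf hΛ, fun θ τ hθ hτ l hl => ?_⟩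
    obtain ⟨l', hl'⟩ := exists_isReading_surfaceOf (isLowerPile_cubes (a := a) (b := b) (c := c)
      (N := N))
    have hcube : ∀ p ∈ cubes a b c N, p ∉ Λ → CubeRelation τ p := by
      rintro ⟨x, y, z⟩ hp hn
      have h := hθ _ hp hn
      have ht := (mem_cubes.1 hp).1
      simp only [CubeRelation, add_e1, add_e2, add_e3] at h ⊢
      have hv : ∀ x' y' z' : ℤ, x + y + z ≤ x' + y' + z' → τ (x', y', z') = θ (x', y', z') :=
        fun x' y' z' h' => hτ _ (by simp only [baseTime, time]; omega)
      rw [hv x y z, hv (x + 1) y z, hv x (y + 1) z, hv (x + 1) (y + 1) (z + 1),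
        hv x (y + 1) (z + 1), hv (x + 1) y (z + 1), h] <;> omega
    have hapex : τ (a, b, c) = θ (a, b, c) := hτ _ (by simp only [baseTime, time]; omega)
    rw [cornerMinor_readingMatrix, act_eq_act_cubes hΛ hl hcube hl', ← cornerMinor_readingMatrix,
      cornerMinor_corner hl', ← Units.val_mul, apex_eq hN, hapex]
  · intro E G hG
    obtain ⟨hU, hM⟩ := hG.isMelted
    obtain ⟨N₀, hN₀⟩ := exists_subset_cubes hU hG.finite
    exact ⟨N₀, fun N hN => ⟨hN₀ N hN, _, hU.isLowerPile_sdiff.intermediateSurface,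
      hM.surfaceOf_subset (hN₀ N hN)⟩⟩
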